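/- Let $n\ge 1$ and $s\in\{1,\dots,1+n\}$ be integers, and put $\nu_k=1$ for $0\le k\le s-1$ and $\nu_k=-1$ for $s\le k\le n$. Let $$M_{\mathrm{red}}=\Big\{\rho\in\mathbb C^{1+n} : \sum_{k=0}^n\nu_k\rho^k\overline{\rho^k}=1\Big\}\Big/\mathrm U(1),\qquad \hat M_{\mathrm{red}}=\Big\{(\xi,\eta)\in\mathbb C^{1+n}\times\mathbb C^{1+n} : \sum_{k=0}^n\nu_k\xi^k\eta^k=1\Big\}\Big/\mathbb C^{\times},$$ where $\mathrm U(1)$ acts by scalar multiplication and $\alpha\in\mathbb C^\times=\mathbb C\setminus\{0\}$ acts by $(\xi,\eta)\mapsto(\alpha\xi,\alpha^{-1}\eta)$. The space $\hat M_{\mathrm{red}}$ is a complex manifold with atlas given by the projective coordinates $\big((\xi^k/\xi^i)_{k\ne i},(\eta^k/\eta^j)_{k\ne j}\big)$ on $\{\xi^i\neq0,\ \eta^j\ne0\}$, $0\le i,j\le n$; for $i=j=0$ these are denoted $u^k=\xi^k/\xi^0$, $v^k=\eta^k/\eta^0$, $1\le k\le n$. Let $\Delta\colon M_{\mathrm{red}}\to\hat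 M_{\mathrm{red}}$, $[\rho]\mapsto[(\rho,\overline\rho)]$, and let $\mathcal A(M_{\mathrm{red}})=\{\hat f\circ\Delta : \hat f\in\mathcal O(\hat M_{\mathrm{red}})\}$, where $\mathcal O(\hat M_{\mathrm{red}})$ is the space of holomorphic functions on $\hat M_{\mathrm{red}}$, with the topology of locally uniform convergence of the holomorphic extensions $\hat f$ to $\hat M_{\mathrm{red}}$. For $P,Q\in\mathbb N_0^n$ the fundamental monomial $f_{P,Q}\in\mathcal A(M_{\mathrm{red}})$ is $$f_{P,Q}([\rho])=(\rho^0)^{\max\{|Q|-|P|,0\}}\,\big(\overline{\rho^0}\big)^{\max\{|P|-|Q|,0\}}\prod_{k=1}^n(\rho^k)^{P_k}\big(\overline{\rho^k}\big)^{Q_k}.$$ Then the fundamental monomials $f_{P,Q}$, $P,Q\in\mathbb N_0^n$, form an absolute Schauder basis of $\mathcal A(M_{\mathrm{red}})$: every $f\in\mathcal A(M_{\mathrm{red}})$ can be expanded in a unique way as an absolutely convergent series $f=\sum_{P,Q\in\mathbb N_0^n}a_{P,Q}(f)\,f_{P,Q}$ with complex coefficients; the coefficients depend linearly and continuously on $f$;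 and for every continuous seminorm $p$ on $\mathcal A(M_{\mathrm{red}})$ there is a continuous seminorm $q$ with $\sum_{P,Q}|a_{P,Q}(f)|\,p(f_{P,Q})\le q(f)$ for all $f$. The coefficients satisfy $$\|f\|_{\mathrm{red},r}:=\sum_{P,Q\in\mathbb N_0^n}|a_{P,Q}(f)|\,r^{|P|+|Q|}<\infty\qquad\text{for all } r\in[1,\infty),$$ and the seminorms $\|\cdot\|_{\mathrm{red},r}$, $r\in[1,\infty)$, define the topology of $\mathcal A(M_{\mathrm{red}})$. Moreover, for every $f\in\mathcal A(M_{\mathrm{red}})$, every $\hat f\in\mathcal O(\hat M_{\mathrm{red}})$ with $\hat f\circ\Delta=f$ and all $P,Q\in\mathbb N_0^n$, $$a_{P,Q}(f)=\frac1{(-4\pi^2)^n}\oint_C\cdots\oint_C\hat f\;\frac{\big(1+\sum_{k=1}^n\nu_ku^kv^k\big)^{\max\{|P|,|Q|\}-1}}{u^{P+(1,\dots,1)}\,v^{Q+(1,\dots,1)}}\;\mathrm d^nu\wedge\mathrm d^nv,$$ where $\hat f$ is expressed in the coordinates $u,v$ and each of the $2n$ variables $u^1,\dots,u^n,v^1,\dots,v^n$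 runs once, counterclockwise, through the circle $C\subseteq\mathbb C$ around $0$ of an arbitrary radius in $(0,1/\sqrt n)$. -/

import Mathlib

noncomputable section

namespace WickRed

/-- The sign `ν_k`, `k = 0, …, n`: it is `+1` for `k ≤ s - 1` and `-1` for `k ≥ s`. -/
def nu (n s : ℕ) (k : Fin (n + 1)) : ℂ := if (k : ℕ) < s then 1 else -1

/-- `𝒥(ρ) = ∑ ν_k ρ^k conj(ρ^k)` on `ℂ^{1+n}`. -/
def momentMap (n s : ℕ) (ρ : Fin (n + 1) → ℂ) : ℂ :=
  ∑ k, nu n s k * ρ k * starRingEnd ℂ (ρ k)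

/-- The holomorphic polynomial `∑ ν_k ξ^k η^k` on `ℂ^{1+n} × ℂ^{1+n}`. -/
def momentMapExt (n s : ℕ) (ξ η : Fin (n + 1) → ℂ) : ℂ :=
  ∑ k, nu n s k * ξ k * η k

/-- The level set `Z = {𝒥 = 1}` in `ℂ^{1+n}`. -/
abbrev LevelSet (n s : ℕ) : Type := {ρ : Fin (n + 1) → ℂ // momentMap n s ρ = 1}

/-- The extended level set in `ℂ^{1+n} × ℂ^{1+n}`. -/
abbrev LevelSetExt (n s : ℕ) : Type :=
  {p : (Fin (n + 1) → ℂ) × (Fin (n + 1) → ℂ) // momentMapExt n s p.1 p.2 = 1}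

/-- The action of `U(1)` on the level set by scalar multiplication. -/
instance (n s : ℕ) : MulAction Circle (LevelSet n s) where
  smul c ρ := ⟨fun k => (c : ℂ) * ρ.1 k, by
    refine Eq.trans ?_ ρ.2
    unfold momentMap
    refine Finset.sum_congr rfl fun k _ => ?_
    have h : (c : ℂ) * starRingEnd ℂ (c : ℂ) = 1 := by
      rw [Complex.mul_conj, Complex.normSq_eq_norm_sq, Circle.norm_coe]; simp
    rw [map_mul]
    linear_combination (nu n s k * ρ.1 k * starRingEnd ℂ (ρ.1 k)) * h⟩
  one_smul ρ := Subtype.ext (funext fun k => by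
    change ((1 : Circle) : ℂ) * ρ.1 k = ρ.1 k
    simp)
  mul_smul c d ρ := Subtype.ext (funext fun k => by
    change ((c * d : Circle) : ℂ) * ρ.1 k = (c : ℂ) * ((d : ℂ) * ρ.1 k)
    rw [Circle.coe_mul, mul_assoc])

/-- The action `α • (ξ, η) = (α ξ, α⁻¹ η)` of `ℂ \ {0}` on the extended level set. -/
instance (n s : ℕ) : MulAction ℂˣ (LevelSetExt n s) where
  smul a p := ⟨(fun k => (a : ℂ) * p.1.1 k, fun k => ((a⁻¹ : ℂˣ) : ℂ) * p.1.2 k), by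
    refine Eq.trans ?_ p.2
    unfold momentMapExt
    refine Finset.sum_congr rfl fun k _ => ?_
    have h : (a : ℂ) * ((a⁻¹ : ℂˣ) : ℂ) = 1 := a.mul_inv
    dsimp only
    linear_combination (nu n s k * p.1.1 k * p.1.2 k) * h⟩
  one_smul p := Subtype.ext (Prod.ext (funext fun k => by
    change ((1 : ℂˣ) : ℂ) * p.1.1 k = p.1.1 k
    simp) (funext fun k => by
    change (((1 : ℂˣ)⁻¹ : ℂˣ) : ℂ) * p.1.2 k = p.1.2 k
    simp))
  mul_smul a b p := Subtype.ext (Prod.ext (funext fun k => by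
    change ((a * b : ℂˣ) : ℂ) * p.1.1 k = (a : ℂ) * ((b : ℂ) * p.1.1 k)
    rw [Units.val_mul, mul_assoc]) (funext fun k => by
    change (((a * b)⁻¹ : ℂˣ) : ℂ) * p.1.2 k = ((a⁻¹ : ℂˣ) : ℂ) * (((b⁻¹ : ℂˣ) : ℂ) * p.1.2 k)
    rw [mul_inv, Units.val_mul, mul_assoc]))

/-- `M_red = Z / U(1)`. -/
abbrev Mred (n s : ℕ) : Type := MulAction.orbitRel.Quotient Circle (LevelSet n s)

/-- The extension of `M_red`: the extended level set modulo `ℂ \ {0}`, with the quotient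
topology. -/
abbrev MredExt (n s : ℕ) : Type := MulAction.orbitRel.Quotient ℂˣ (LevelSetExt n s)

/-- The class `[(ξ, η)]` in the extension of `M_red`. -/
def mkExt (n s : ℕ) (ξ η : Fin (n + 1) → ℂ) (h : momentMapExt n s ξ η = 1) : MredExt n s :=
  Quotient.mk _ ⟨(ξ, η), h⟩

/-- The map `M_red → MredExt`, `[ρ] ↦ [(ρ, conj ρ)]`. -/
def antidiagonal (n s : ℕ) : Mred n s → MredExt n s :=
  Quotient.lift (fun ρ : LevelSet n s => mkExt n s ρ.1 (fun k => starRingEnd ℂ (ρ.1 k)) ρ.2) (by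
    rintro ρ σ ⟨c, rfl⟩
    refine Quotient.sound ⟨Circle.toUnits c, Subtype.ext (Prod.ext rfl (funext fun k => ?_))⟩
    change (((Circle.toUnits c)⁻¹ : ℂˣ) : ℂ) * starRingEnd ℂ (σ.1 k)
      = starRingEnd ℂ ((c : ℂ) * σ.1 k)
    rw [map_mul, ← map_inv, ← Circle.coe_inv_eq_conj]
    rfl)

/-! ### The standard holomorphic atlas -/

/-- The vector of homogeneous coordinates with entry `1` at position `i` and the other entries
given by `u`, in order. -/
def homog {n : ℕ} (i : Fin (n + 1)) (u : Fin n → ℂ) : Fin (n + 1) → ℂ :=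
  i.insertNth (α := fun _ => ℂ) 1 u

/-- The projective coordinates `([(ξ, η)]) ↦ ((ξ^k / ξ^i)_{k ≠ i}, (η^k / η^j)_{k ≠ j})`. They form
a chart on `{ξ^i ≠ 0, η^j ≠ 0}`. For `i = j = 0` these are the coordinates `(u, v)`. -/
def projCoord (n s : ℕ) (i j : Fin (n + 1)) : MredExt n s → (Fin n → ℂ) × (Fin n → ℂ) :=
  Quotient.lift (fun p : LevelSetExt n s =>
    (fun k => p.1.1 (i.succAbove k) / p.1.1 i, fun k => p.1.2 (j.succAbove k) / p.1.2 j)) (by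
    rintro p q ⟨a, rfl⟩
    refine Prod.ext (funext fun k => ?_) (funext fun k => ?_)
    · change (a : ℂ) * q.1.1 (i.succAbove k) / ((a : ℂ) * q.1.1 i) = _
      exact mul_div_mul_left _ _ a.ne_zero
    · change ((a⁻¹ : ℂˣ) : ℂ) * q.1.2 (j.succAbove k) / (((a⁻¹ : ℂˣ) : ℂ) * q.1.2 j) = _
      exact mul_div_mul_left _ _ (a⁻¹).ne_zero)

/-- The open subset of `ℂⁿ × ℂⁿ` onto which the coordinates `projCoord n s i j` map their domain. -/
def coordRange (n s : ℕ) (i j : Fin (n + 1)) : Set ((Fin n → ℂ) × (Fin n → ℂ)) :=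
  {p | momentMapExt n s (homog i p.1) (homog j p.2) ≠ 0}

theorem momentMapExt_normalize (n s : ℕ) {ξ η : Fin (n + 1) → ℂ} (h : momentMapExt n s ξ η ≠ 0) :
    momentMapExt n s (fun k => ξ k / momentMapExt n s ξ η) η = 1 := by
  have : momentMapExt n s (fun k => ξ k / momentMapExt n s ξ η) η
      = momentMapExt n s ξ η / momentMapExt n s ξ η := by
    conv_lhs => unfold momentMapExt
    conv_rhs => lhs; unfold momentMapExt
    rw [Finset.sum_div]
    exact Finset.sum_congr rfl fun k _ => by
      simp only [momentMapExt]
      ring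
  rw [this, div_self h]

/-- The inverse of the chart `projCoord n s i j`: the point with given projective coordinates. -/
def coordPoint (n s : ℕ) (i j : Fin (n + 1)) (p : (Fin n → ℂ) × (Fin n → ℂ))
    (h : p ∈ coordRange n s i j) : MredExt n s :=
  mkExt n s (fun k => homog i p.1 k / momentMapExt n s (homog i p.1) (homog j p.2)) (homog j p.2)
    (momentMapExt_normalize n s h)

theorem projCoord_coordPoint (n s : ℕ) (i j : Fin (n + 1)) (p : (Fin n → ℂ) × (Fin n → ℂ))
    (h : p ∈ coordRange n s i j) : projCoord n s i j (coordPoint n s i j p h) = p := by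
  have h' : momentMapExt n s (homog i p.1) (homog j p.2) ≠ 0 := h
  refine Prod.ext (funext fun k => ?_) (funext fun k => ?_)
  · change homog i p.1 (i.succAbove k) / momentMapExt n s (homog i p.1) (homog j p.2)
      / (homog i p.1 i / momentMapExt n s (homog i p.1) (homog j p.2)) = _
    rw [div_div_div_cancel_right₀ h']
    simp [homog]
  · change homog j p.2 (j.succAbove k) / homog j p.2 j = _
    simp [homog]

/-- Points with `ξ^i ≠ 0` and `η^j ≠ 0` are recovered from their coordinates, so `projCoord n s i j`
is a bijection from `{ξ^i ≠ 0, η^j ≠ 0}` onto `coordRange n s i j`. -/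
theorem coordPoint_projCoord (n s : ℕ) (i j : Fin (n + 1)) (ξ η : Fin (n + 1) → ℂ)
    (h : momentMapExt n s ξ η = 1) (hi : ξ i ≠ 0) (hj : η j ≠ 0) :
    ∃ hp : projCoord n s i j (mkExt n s ξ η h) ∈ coordRange n s i j,
      coordPoint n s i j (projCoord n s i j (mkExt n s ξ η h)) hp = mkExt n s ξ η h := by
  have h1 : homog i (projCoord n s i j (mkExt n s ξ η h)).1 = fun k => ξ k / ξ i := by
    funext k
    refine Fin.succAboveCases i ?_ (fun l => ?_) k
    · simp [homog, hi]
    · simp only [homog, Fin.insertNth_apply_succAbove]; rfl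
  have h2 : homog j (projCoord n s i j (mkExt n s ξ η h)).2 = fun k => η k / η j := by
    funext k
    refine Fin.succAboveCases j ?_ (fun l => ?_) k
    · simp [homog, hj]
    · simp only [homog, Fin.insertNth_apply_succAbove]; rfl
  have h3 : momentMapExt n s (fun k => ξ k / ξ i) (fun k => η k / η j) = (ξ i * η j)⁻¹ := by
    have : momentMapExt n s (fun k => ξ k / ξ i) (fun k => η k / η j)
        = momentMapExt n s ξ η * (ξ i * η j)⁻¹ := by
      unfold momentMapExt
      rw [Finset.sum_mul]
      exact Finset.sum_congr rfl fun k _ => by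
        rw [mul_inv]
        ring
    rw [this, h, one_mul]
  have hp : projCoord n s i j (mkExt n s ξ η h) ∈ coordRange n s i j := by
    change momentMapExt n s _ _ ≠ 0
    rw [h1, h2, h3]
    exact inv_ne_zero (mul_ne_zero hi hj)
  refine ⟨hp, Quotient.sound ⟨Units.mk0 (η j) hj, Subtype.ext (Prod.ext (funext fun k => ?_)
    (funext fun k => ?_))⟩⟩
  · change η j * ξ k = homog i (projCoord n s i j (mkExt n s ξ η h)).1 k
      / momentMapExt n s (homog i (projCoord n s i j (mkExt n s ξ η h)).1)
          (homog j (projCoord n s i j (mkExt n s ξ η h)).2)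
    rw [h1, h2, h3]
    field_simp
  · change (((Units.mk0 (η j) hj)⁻¹ : ℂˣ) : ℂ) * η k
      = homog j (projCoord n s i j (mkExt n s ξ η h)).2 k
    rw [h2, Units.val_inv_eq_inv_val, Units.val_mk0]
    field_simp

open scoped Classical in
/-- The coordinate expression of a function in the chart `projCoord n s i j`, continued by `0`
outside of `coordRange n s i j`. -/
def coordExpr (n s : ℕ) (i j : Fin (n + 1)) (g : MredExt n s → ℂ)
    (p : (Fin n → ℂ) × (Fin n → ℂ)) : ℂ :=
  if h : p ∈ coordRange n s i j then g (coordPoint n s i j p h) else 0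

/-- A function on the extension of `M_red` is holomorphic if all its expressions in the charts of
the standard atlas are holomorphic. -/
def IsHolomorphic (n s : ℕ) (g : MredExt n s → ℂ) : Prop :=
  ∀ i j : Fin (n + 1), DifferentiableOn ℂ (coordExpr n s i j g) (coordRange n s i j)

/-- The holomorphic functions on the extension of `M_red`. As a subspace of the space of continuous
functions with the compact-open topology it carries the topology of locally uniform convergence. -/
def Holo (n s : ℕ) : Submodule ℂ C(MredExt n s, ℂ) where
  carrier := {g | IsHolomorphic n s g}
  zero_mem' := fun i j => (differentiableOn_const (0 : ℂ)).congr fun p hp => by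
    rw [coordExpr, dif_pos hp]; rfl
  add_mem' := fun {f g} hf hg i j => ((hf i j).add (hg i j)).congr fun p hp => by
    simp only [Pi.add_apply]
    rw [coordExpr, coordExpr, coordExpr, dif_pos hp, dif_pos hp, dif_pos hp]; rfl
  smul_mem' := fun c f hf i j => ((hf i j).const_smul c).congr fun p hp => by
    simp only [Pi.smul_apply]
    rw [coordExpr, coordExpr, dif_pos hp, dif_pos hp]; rfl

/-! ### Analytic functions on `M_red` -/

/-- The pullback of holomorphic functions to functions on `M_red` along `antidiagonal`. -/
def pullback (n s : ℕ) : Holo n s →ₗ[ℂ] (Mred n s → ℂ) where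
  toFun g := fun x => g.1 (antidiagonal n s x)
  map_add' _ _ := rfl
  map_smul' _ _ := rfl

/-- The space `𝒜(M_red)` of all functions on `M_red` that are pullbacks of holomorphic functions on
the extension of `M_red`. -/
def Analytic (n s : ℕ) : Type := LinearMap.range (pullback n s)

instance (n s : ℕ) : AddCommGroup (Analytic n s) :=
  inferInstanceAs (AddCommGroup (LinearMap.range (pullback n s)))

instance (n s : ℕ) : Module ℂ (Analytic n s) :=
  inferInstanceAs (Module ℂ (LinearMap.range (pullback n s)))

/-- The pullback as a linear surjection from the holomorphic functions onto `𝒜(M_red)`. -/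
def restrict (n s : ℕ) : Holo n s →ₗ[ℂ] Analytic n s := (pullback n s).rangeRestrict

/-- The topology of `𝒜(M_red)` is the one coming from the topology of locally uniform convergence
of holomorphic functions on the extension of `M_red` via the linear surjection `restrict`. (This
map is injective, because holomorphic functions are determined by their restriction to the
antidiagonal, so that this is the topology transported along it.) -/
instance (n s : ℕ) : TopologicalSpace (Analytic n s) :=
  TopologicalSpace.coinduced (restrict n s) inferInstance

/-! ### Monomials -/

/-- The holomorphic monomial `[(ξ, η)] ↦ ξ^P η^Q`, for `|P| = |Q|`. -/
def monomExt (n s : ℕ) (P Q : Fin (n + 1) → ℕ) (h : ∑ k, P k = ∑ k, Q k) : MredExt n s → ℂ :=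
  Quotient.lift (fun p : LevelSetExt n s => (∏ k, p.1.1 k ^ P k) * ∏ k, p.1.2 k ^ Q k) (by
    rintro p q ⟨a, rfl⟩
    change (∏ k, ((a : ℂ) * q.1.1 k) ^ P k) * ∏ k, (((a⁻¹ : ℂˣ) : ℂ) * q.1.2 k) ^ Q k = _
    simp only [mul_pow, Finset.prod_mul_distrib, Finset.prod_pow_eq_pow_sum, ← h]
    have h1 : (a : ℂ) ^ (∑ k, P k) * ((a⁻¹ : ℂˣ) : ℂ) ^ (∑ k, P k) = 1 := by
      rw [← mul_pow, a.mul_inv, one_pow]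
    linear_combination ((∏ k, q.1.1 k ^ P k) * ∏ k, q.1.2 k ^ Q k) * h1)

/-- The reduced monomial `[ρ] ↦ ρ^P conj(ρ)^Q` on `M_red`, for `|P| = |Q|`. -/
def monomRed (n s : ℕ) (P Q : Fin (n + 1) → ℕ) (h : ∑ k, P k = ∑ k, Q k) : Mred n s → ℂ :=
  Quotient.lift
    (fun ρ : LevelSet n s => (∏ k, ρ.1 k ^ P k) * ∏ k, starRingEnd ℂ (ρ.1 k) ^ Q k) (by
    rintro p q ⟨a, rfl⟩
    change (∏ k, ((a : ℂ) * q.1 k) ^ P k) * ∏ k, starRingEnd ℂ ((a : ℂ) * q.1 k) ^ Q k = _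
    simp only [map_mul, mul_pow, Finset.prod_mul_distrib, Finset.prod_pow_eq_pow_sum, ← h]
    have h0 : (a : ℂ) * starRingEnd ℂ (a : ℂ) = 1 := by
      rw [Complex.mul_conj, Complex.normSq_eq_norm_sq, Circle.norm_coe]; simp
    have h1 : (a : ℂ) ^ (∑ k, P k) * starRingEnd ℂ (a : ℂ) ^ (∑ k, P k) = 1 := by
      rw [← mul_pow, h0, one_pow]
    linear_combination ((∏ k, q.1 k ^ P k) * ∏ k, starRingEnd ℂ (q.1 k) ^ Q k) * h1)

theorem differentiable_homog {n : ℕ} (i k : Fin (n + 1)) :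
    Differentiable ℂ fun u : Fin n → ℂ => homog i u k := by
  refine Fin.succAboveCases i ?_ (fun l => ?_) k
  · simp [homog]
  · simp only [homog, Fin.insertNth_apply_succAbove]
    fun_prop

theorem differentiable_homog_fst {n : ℕ} (i k : Fin (n + 1)) :
    Differentiable ℂ fun p : (Fin n → ℂ) × (Fin n → ℂ) => homog i p.1 k :=
  (differentiable_homog i k).comp differentiable_fst

theorem differentiable_homog_snd {n : ℕ} (i k : Fin (n + 1)) :
    Differentiable ℂ fun p : (Fin n → ℂ) × (Fin n → ℂ) => homog i p.2 k :=
  (differentiable_homog i k).comp differentiable_snd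

theorem differentiableOn_finsetProd {ι E : Type*} [NormedAddCommGroup E] [NormedSpace ℂ E]
    (t : Finset ι) (f : ι → E → ℂ) (S : Set E) (hf : ∀ k, DifferentiableOn ℂ (f k) S) :
    DifferentiableOn ℂ (fun x => ∏ k ∈ t, f k x) S := by
  classical
  induction t using Finset.induction_on with
  | empty => simp
  | insert a t ha ih =>
    simp only [Finset.prod_insert ha]
    exact (hf a).fun_mul ih

theorem isHolomorphic_monomExt (n s : ℕ) (P Q : Fin (n + 1) → ℕ) (h : ∑ k, P k = ∑ k, Q k) :
    IsHolomorphic n s (monomExt n s P Q h) := by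
  intro i j
  have hJ : Differentiable ℂ fun p : (Fin n → ℂ) × (Fin n → ℂ) =>
      momentMapExt n s (homog i p.1) (homog j p.2) := by
    unfold momentMapExt
    exact Differentiable.fun_sum fun k _ =>
      ((differentiable_homog_fst i k).const_mul _).mul (differentiable_homog_snd j k)
  have key : DifferentiableOn ℂ (fun p : (Fin n → ℂ) × (Fin n → ℂ) =>
      (∏ k, (homog i p.1 k / momentMapExt n s (homog i p.1) (homog j p.2)) ^ P k) *
        ∏ k, homog j p.2 k ^ Q k) (coordRange n s i j) := by
    refine DifferentiableOn.fun_mul (differentiableOn_finsetProd _ _ _ fun k => ?_)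
      (differentiableOn_finsetProd _ _ _ fun k => ?_)
    · simp only [div_eq_mul_inv]
      exact ((differentiable_homog_fst i k).differentiableOn.fun_mul
        (hJ.differentiableOn.fun_inv fun p hp => hp)).fun_pow _
    · exact ((differentiable_homog_snd j k).differentiableOn).fun_pow _
  refine key.congr fun p hp => ?_
  rw [coordExpr, dif_pos hp]
  rfl

theorem continuous_monomExt (n s : ℕ) (P Q : Fin (n + 1) → ℕ) (h : ∑ k, P k = ∑ k, Q k) :
    Continuous (monomExt n s P Q h) := by
  refine Continuous.quotient_lift ?_ _
  have h1 : Continuous fun p : LevelSetExt n s => p.1 := continuous_subtype_val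
  fun_prop

theorem monomRed_mem (n s : ℕ) (P Q : Fin (n + 1) → ℕ) (h : ∑ k, P k = ∑ k, Q k) :
    monomRed n s P Q h ∈ LinearMap.range (pullback n s) := by
  refine ⟨⟨⟨monomExt n s P Q h, continuous_monomExt n s P Q h⟩,
    isHolomorphic_monomExt n s P Q h⟩, funext fun x => ?_⟩
  induction x using Quotient.inductionOn with
  | h ρ => rfl

/-- The degree `|P|` of a multiindex. -/
def deg {n : ℕ} (P : Fin n → ℕ) : ℕ := ∑ k, P k

theorem fund_deg {n : ℕ} (P Q : Fin n → ℕ) :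
    ∑ k, (Fin.cons (deg Q - deg P) P : Fin (n + 1) → ℕ) k
      = ∑ k, (Fin.cons (deg P - deg Q) Q : Fin (n + 1) → ℕ) k := by
  simp only [Fin.sum_univ_succ, Fin.cons_zero, Fin.cons_succ]
  change deg Q - deg P + deg P = deg P - deg Q + deg Q
  omega

/-- The fundamental monomial on `M_red` for `P, Q ∈ ℕ₀ⁿ`: the reduced monomial with multiindices
`(|Q| - |P|, P)` and `(0, Q)` if `|P| ≤ |Q|`, and `(0, P)` and `(|P| - |Q|, Q)` if `|P| ≥ |Q|`.
(Subtraction of natural numbers is truncated at `0`.) -/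
def fundMonom (n s : ℕ) (i : (Fin n → ℕ) × (Fin n → ℕ)) : Analytic n s :=
  ⟨monomRed n s (Fin.cons (deg i.2 - deg i.1) i.1) (Fin.cons (deg i.1 - deg i.2) i.2)
    (fund_deg i.1 i.2), monomRed_mem n s _ _ _⟩

/-! ### Absolute Schauder bases -/

/-- The family `e` is an absolute Schauder basis of the topological vector space `E` with
coefficient functionals `c`: every vector is the sum of the series of the `c i x • e i`, the
coefficients are unique (also if one only has convergence of the partial sums for some enumeration
of the index set) and depend continuously on `x`, and all expansions converge absolutely, in the
sense that for every continuous seminorm `p` the sums of the `|c i x| p(e i)` are finite and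
bounded by a continuous seminorm. -/
structure IsAbsoluteSchauderBasis {ι E : Type*} [AddCommGroup E] [Module ℂ E] [TopologicalSpace E]
    (e : ι → E) (c : ι → (E →L[ℂ] ℂ)) : Prop where
  hasSum : ∀ x : E, HasSum (fun i => c i x • e i) x
  unique : ∀ (x : E) (a : ι → ℂ), HasSum (fun i => a i • e i) x → a = fun i => c i x
  unique_enum : ∀ (σ : ℕ ≃ ι) (x : E) (a : ι → ℂ),
    Filter.Tendsto (fun N => ∑ m ∈ Finset.range N, a (σ m) • e (σ m)) Filter.atTop (nhds x) →
      a = fun i => c i x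
  absolute : ∀ p : Seminorm ℂ E, Continuous p → ∃ q : Seminorm ℂ E, Continuous q ∧
    ∀ x : E, Summable (fun i => ‖c i x‖ * p (e i)) ∧ ∑' i, ‖c i x‖ * p (e i) ≤ q x

end WickRed

end

noncomputable section

namespace WickRed

open MeasureTheory

/-! ### Normalized arc length on circles and tori -/

/-! Normalizing either `η^0 = 1` or `ξ^0 = 1` and solving `∑ ν_k ξ^k η^k = 1` for the other zeroth
coordinate gives two maps `paramL`, `paramR` from `ℂⁿ × ℂⁿ` to the extended space. A holomorphic `g`
pulls back along them to two entire functions `G_L`, `G_R`. With `c = 1 - ∑ ν_k x_k y_k ≠ 0` they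
satisfy `G_L (x, y) = G_R (x / c, c y)`.

The monomial `f_{P,Q}` is exactly `x^P y^Q` in `paramL` if `|P| ≥ |Q|`, and in `paramR` if `|P| ≤
|Q|`. So `a_{P,Q}` is defined as a Taylor coefficient of `G_L` in the first case and of `G_R`
otherwise (`holoCoeff`). The substitution `(z x, z⁻¹ y)`, `|z| = 1`, leaves `c` fixed and multiplies
`x^P y^Q` by `z^(|P|-|Q|)`. Hence the Taylor series of `G_L` at `(x, y)` and that of `G_R` at `(x /
c, c y)` have the same homogeneous parts with respect to `|P| - |Q|`, and the parts with `|P| < |Q|`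
may be taken from the second (`hasSum_of_laurent_eq`, `hasSum_holoCoeff_paramL`). Continuity carries
the expansion to the points where `ξ^0` or `η^0` vanishes (`eq_of_eq_on_generic`,
`hasSum_holoCoeff`).

Cauchy estimates bound the weighted `ℓ¹` norms of the coefficients by suprema over compact sets.
Conversely `|f_{P,Q}| ≤ r^(|P|+|Q|)` where `‖ξ‖ ‖η‖ ≤ r`, `r ≥ 1`, bounds suprema by these norms. So
they define the compact-open topology (`withSeminorms_holoSeminorm`).

For the integral formula, in the chart `(u, v)` with `c = 1 + ∑ ν_k u_k v_k` the point is `paramL (u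
/ c, v) = paramR (u, v / c)`. Expanding the entire function and integrating term by term reduces the
claim to an orthogonality relation for powers of `c` (`laurentCoeff_quadric_zpow`,
`laurentCoeff_comp_quadric`).

Restriction to the antidiagonal is injective, since a holomorphic function near `0` vanishing for `v
= conj u` is zero (`restrict_injective`). Hence everything transports to `𝒜(M_red)`. -/

/-- The normalized arc length on the circle of radius `R` around `0`. -/
def circ (R : ℝ) : Measure ℂ :=
  (ENNReal.ofReal (2 * Real.pi))⁻¹ •
    (volume.restrict (Set.Icc 0 (2 * Real.pi))).map (circleMap 0 R)

instance (R : ℝ) : IsProbabilityMeasure (circ R) := by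
  refine ⟨?_⟩
  rw [circ, Measure.smul_apply, Measure.map_apply (measurable_circleMap 0 R) MeasurableSet.univ]
  simp only [Set.preimage_univ, Measure.restrict_apply MeasurableSet.univ, Set.univ_inter,
    Real.volume_Icc, sub_zero, smul_eq_mul]
  exact ENNReal.inv_mul_cancel (by simp [Real.pi_pos]) ENNReal.ofReal_ne_top

theorem ae_circ {R : ℝ} (hR : 0 ≤ R) : ∀ᵐ z ∂circ R, z ∈ Metric.sphere (0 : ℂ) R := by
  refine Measure.ae_smul_measure ?_ _
  refine (ae_map_iff (measurable_circleMap 0 R).aemeasurable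
    (Metric.isClosed_sphere (ε := R)).measurableSet).2 ?_
  exact Filter.Eventually.of_forall fun θ => circleMap_mem_sphere 0 hR θ

theorem integral_circ {R : ℝ} {f : ℂ → ℂ} (hf : AEStronglyMeasurable f (circ R)) :
    ∫ z, f z ∂circ R = Real.circleAverage f 0 R := by
  have hf' : AEStronglyMeasurable f
      ((volume.restrict (Set.Icc 0 (2 * Real.pi))).map (circleMap 0 R)) := by
    refine hf.mono_ac (Measure.absolutelyContinuous_smul ?_)
    exact ENNReal.inv_ne_zero.2 ENNReal.ofReal_ne_top
  rw [circ, integral_smul_measure, integral_map (measurable_circleMap 0 R).aemeasurable hf',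
    Real.circleAverage, intervalIntegral.integral_of_le Real.two_pi_pos.le,
    integral_Icc_eq_integral_Ioc, ENNReal.toReal_inv,
    ENNReal.toReal_ofReal Real.two_pi_pos.le]

/-- The torus of all `z` with `|z_k| = R` for all `k`. -/
def torusSet (n : ℕ) (R : ℝ) : Set (Fin n → ℂ) := Set.univ.pi fun _ => Metric.sphere 0 R

/-- The normalized product measure on the torus. -/
abbrev torus (n : ℕ) (R : ℝ) : Measure (Fin n → ℂ) := Measure.pi fun _ => circ R

theorem mem_torusSet {n : ℕ} {R : ℝ} {z : Fin n → ℂ} : z ∈ torusSet n R ↔ ∀ k, ‖z k‖ = R := by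
  simp [torusSet, Set.mem_pi]

theorem isCompact_torusSet (n : ℕ) (R : ℝ) : IsCompact (torusSet n R) :=
  isCompact_univ_pi fun _ => isCompact_sphere 0 R

theorem ne_zero_of_mem_torusSet {n : ℕ} {R : ℝ} (hR : 0 < R) {z : Fin n → ℂ}
    (hz : z ∈ torusSet n R) (k : Fin n) : z k ≠ 0 :=
  norm_pos_iff.1 (by rw [mem_torusSet.1 hz k]; exact hR)

theorem torusSet_subset_closedBall {n : ℕ} {R : ℝ} (hR : 0 ≤ R) :
    torusSet n R ⊆ Metric.closedBall 0 R := fun z hz => by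
  rw [mem_closedBall_zero_iff, pi_norm_le_iff_of_nonneg hR]
  exact fun k => (mem_torusSet.1 hz k).le

theorem ae_torus {n : ℕ} {R : ℝ} (hR : 0 ≤ R) : ∀ᵐ z ∂torus n R, z ∈ torusSet n R := by
  have : ∀ᵐ z ∂torus n R, ∀ k, z k ∈ Metric.sphere (0 : ℂ) R :=
    Filter.eventually_all.2 fun k => Measure.tendsto_eval_ae_ae.eventually (ae_circ hR)
  exact this.mono fun z hz => fun k _ => hz k

theorem integrable_of_continuousOn {X : Type*} [TopologicalSpace X] [T2Space X] [MeasurableSpace X]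
    [OpensMeasurableSpace X] [TopologicalSpace.PseudoMetrizableSpace X] {μ : Measure X}
    [IsFiniteMeasure μ] {K : Set X}
    (hK : IsCompact K) (hμ : ∀ᵐ x ∂μ, x ∈ K) {f : X → ℂ} (hf : ContinuousOn f K) :
    Integrable f μ := by
  have h : IntegrableOn f K μ := hf.integrableOn_compact hK
  rwa [IntegrableOn, Measure.restrict_eq_self_of_ae_mem hμ] at h

theorem integrable_circ {R : ℝ} (hR : 0 ≤ R) {f : ℂ → ℂ}
    (hf : ContinuousOn f (Metric.sphere 0 R)) : Integrable f (circ R) :=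
  integrable_of_continuousOn (isCompact_sphere 0 R) (ae_circ hR) hf

theorem integrable_torus {n : ℕ} {R : ℝ} (hR : 0 ≤ R) {f : (Fin n → ℂ) → ℂ}
    (hf : ContinuousOn f (torusSet n R)) : Integrable f (torus n R) :=
  integrable_of_continuousOn (isCompact_torusSet n R) (ae_torus hR) hf

/-- Integration over the torus by first integrating over the coordinate `k`. -/
theorem integral_torus_succAbove {n : ℕ} {R : ℝ} (hR : 0 ≤ R) (k : Fin (n + 1))
    {f : (Fin (n + 1) → ℂ) → ℂ} (hf : ContinuousOn f (torusSet (n + 1) R)) :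
    ∫ z, f z ∂torus (n + 1) R =
      ∫ y, ∫ x, f (k.insertNth (α := fun _ => ℂ) x y) ∂circ R ∂torus n R := by
  have h := (measurePreserving_piFinSuccAbove (fun _ : Fin (n + 1) => circ R) k).symm
  have hint := integrable_torus hR hf
  rw [← h.integrable_comp_emb (MeasurableEquiv.measurableEmbedding _)] at hint
  rw [← h.integral_comp (MeasurableEquiv.measurableEmbedding _)]
  exact integral_prod_symm _ hint

/-- Normalized arc length is `dz / (2πi z)`, so Cauchy's kernel `1 / (z - w)` takes the form `z / (z
- w)`. -/
theorem integral_circ_cauchy {R : ℝ} (hR : 0 < R) {f : ℂ → ℂ}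
    (hf : DifferentiableOn ℂ f (Metric.closedBall 0 R)) {w : ℂ} (hw : ‖w‖ < R) :
    ∫ z, z / (z - w) * f z ∂circ R = f w := by
  have hR' : |R| = R := abs_of_pos hR
  have hd : DiffContOnCl ℂ f (Metric.ball 0 |R|) := by
    exact DifferentiableOn.diffContOnCl_ball hf (by rw [hR'])
  have := hd.circleAverage_smul_div (w := w) (by simpa [hR'] using hw)
  rw [integral_circ, ← this]
  · simp
  · refine (integrable_circ hR.le (ContinuousOn.mul (continuousOn_id.div
      (continuousOn_id.sub continuousOn_const) fun z hz h => ?_) (hf.continuousOn.mono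
        Metric.sphere_subset_closedBall))).aestronglyMeasurable
    have : z = w := sub_eq_zero.1 h
    rw [this, mem_sphere_zero_iff_norm] at hz
    exact hw.ne hz

/-- Cauchy's integral formula on polydiscs. -/
theorem integral_torus_cauchy {n : ℕ} {R : ℝ} (hR : 0 < R) {f : (Fin n → ℂ) → ℂ}
    (hf : DifferentiableOn ℂ f (Metric.closedBall 0 R)) {w : Fin n → ℂ} (hw : ∀ k, ‖w k‖ < R) :
    ∫ z, (∏ k, z k / (z k - w k)) * f z ∂torus n R = f w := by
  induction n with
  | zero =>
    have : ∀ z : Fin 0 → ℂ, (∏ k, z k / (z k - w k)) * f z = f w := fun z => by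
      rw [Subsingleton.elim z w]; simp
    rw [funext this]
    simp
  | succ n ih =>
    have hne : ∀ z ∈ torusSet (n + 1) R, ∀ k, z k - w k ≠ 0 := fun z hz k h => by
      have := mem_torusSet.1 hz k
      rw [sub_eq_zero.1 h] at this
      exact (hw k).ne this
    have hc : ContinuousOn (fun z : Fin (n + 1) → ℂ => (∏ k, z k / (z k - w k)) * f z)
        (torusSet (n + 1) R) := by
      refine ContinuousOn.mul (continuousOn_finsetProd _ fun k _ => ContinuousOn.div
        (by fun_prop) (by fun_prop) fun z hz => hne z hz k) (hf.continuousOn.mono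
          (torusSet_subset_closedBall hR.le))
    rw [integral_torus_succAbove hR.le 0 hc]
    -- The one-variable formula in the zeroth coordinate, the others being frozen on the torus;
    -- induction handles the rest.
    have key : ∀ y ∈ torusSet n R, ∫ x, (∏ k, (Fin.insertNth (α := fun _ => ℂ) 0 x y) k /
        ((Fin.insertNth (α := fun _ => ℂ) 0 x y) k - w k)) *
          f (Fin.insertNth (α := fun _ => ℂ) 0 x y) ∂circ R
        = (∏ k, y k / (y k - w k.succ)) * f (Fin.insertNth (α := fun _ => ℂ) 0 (w 0) y) := by
      intro y hy
      have h1 := integral_circ_cauchy hR (f := fun x => f (Fin.insertNth (α := fun _ => ℂ) 0 x y))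
        (w := w 0) (hf.comp (Differentiable.differentiableOn ?_) fun x hx => ?_) (hw 0)
      · rw [← h1, ← integral_const_mul]
        refine integral_congr_ae (Filter.Eventually.of_forall fun x => ?_)
        simp only [Fin.prod_univ_succ, Fin.insertNth_zero', Fin.cons_zero, Fin.cons_succ]
        ring
      · rw [differentiable_pi]
        intro k
        refine Fin.cases ?_ (fun l => ?_) k <;> simp
      · rw [mem_closedBall_zero_iff] at hx
        rw [mem_closedBall_zero_iff, pi_norm_le_iff_of_nonneg hR.le]
        intro k
        refine Fin.cases ?_ (fun l => ?_) k
        · simpa using hx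
        · simpa using (mem_torusSet.1 hy l).le
    rw [integral_congr_ae ((ae_torus hR.le).mono key)]
    refine (ih (f := fun y => f (Fin.insertNth (α := fun _ => ℂ) 0 (w 0) y))
        (w := fun k => w k.succ) (hf.comp (Differentiable.differentiableOn ?_) fun y hy => ?_)
        fun k => hw k.succ).trans ?_
    · rw [differentiable_pi]
      intro k
      refine Fin.cases ?_ (fun l => ?_) k <;> simp
      fun_prop
    · rw [mem_closedBall_zero_iff, pi_norm_le_iff_of_nonneg hR.le] at hy ⊢
      intro k
      refine Fin.cases ?_ (fun l => ?_) k
      · simpa using (hw 0).le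
      · simpa using hy l
    · congr 1
      ext k
      refine Fin.cases ?_ (fun l => ?_) k <;> simp

/-! ### Laurent monomials and Laurent coefficients -/

/-- The Laurent monomial `∏ z_k ^ A_k`. -/
def zmon {n : ℕ} (A : Fin n → ℤ) (z : Fin n → ℂ) : ℂ := ∏ k, z k ^ A k

theorem zmon_zero {n : ℕ} (z : Fin n → ℂ) : zmon 0 z = 1 := by simp [zmon]

theorem zmon_add {n : ℕ} (A B : Fin n → ℤ) {z : Fin n → ℂ} (hz : ∀ k, z k ≠ 0) :
    zmon (A + B) z = zmon A z * zmon B z := by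
  simp only [zmon, ← Finset.prod_mul_distrib, Pi.add_apply]
  exact Finset.prod_congr rfl fun k _ => zpow_add₀ (hz k) _ _

theorem norm_zmon {n : ℕ} {R : ℝ} (A : Fin n → ℤ) {z : Fin n → ℂ} (hz : z ∈ torusSet n R) :
    ‖zmon A z‖ = ∏ k, R ^ A k := by
  simp only [zmon, norm_prod, norm_zpow, mem_torusSet.1 hz]

theorem continuousOn_zmon {n : ℕ} {R : ℝ} (hR : 0 < R) (A : Fin n → ℤ) :
    ContinuousOn (zmon A) (torusSet n R) :=
  continuousOn_finsetProd _ fun k _ => (continuous_apply k).continuousOn.zpow₀ _ fun _ hz =>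
    Or.inl (ne_zero_of_mem_torusSet hR hz k)

/-- A holomorphic function has no Laurent coefficients with negative indices. -/
theorem integral_torus_mul_zmon_eq_zero {n : ℕ} {R : ℝ} (hR : 0 < R) {f : (Fin n → ℂ) → ℂ}
    (hf : DifferentiableOn ℂ f (Metric.closedBall 0 R)) {A : Fin n → ℤ} {k : Fin n} (hk : 0 < A k) :
    ∫ z, f z * zmon A z ∂torus n R = 0 := by
  cases n with
  | zero => exact k.elim0
  | succ n =>
    have hc : ContinuousOn (fun z => f z * zmon A z) (torusSet (n + 1) R) :=
      (hf.continuousOn.mono (torusSet_subset_closedBall hR.le)).mul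
        (continuousOn_zmon hR A)
    rw [integral_torus_succAbove hR.le k hc]
    refine integral_eq_zero_of_ae ((ae_torus hR.le).mono fun y hy => ?_)
    obtain ⟨m, hm⟩ : ∃ m : ℕ, A k = m := ⟨(A k).toNat, by omega⟩
    -- In the coordinate `k` the integrand is a constant times `f x^m` with `m > 0`. Cauchy's
    -- formula at `w = 0` evaluates its mean to its value at `0`, which is zero because of the
    -- factor `x^m`.
    have h1 := integral_circ_cauchy hR
      (f := fun x => f (k.insertNth (α := fun _ => ℂ) x y) * x ^ m)
      (w := 0) (DifferentiableOn.fun_mul (hf.comp (f := fun x => k.insertNth (α := fun _ => ℂ) x y)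
        (Differentiable.differentiableOn ?_) fun x hx => ?_) (by fun_prop)) (by simpa using hR)
    · rw [zero_pow (by omega), mul_zero] at h1
      calc ∫ x, f (k.insertNth (α := fun _ => ℂ) x y) *
              zmon A (k.insertNth (α := fun _ => ℂ) x y) ∂circ R
          = ∫ x, (∏ j, y j ^ A (k.succAbove j)) * (x / (x - 0) *
              (f (k.insertNth (α := fun _ => ℂ) x y) * x ^ m)) ∂circ R := by
            refine integral_congr_ae ((ae_circ hR.le).mono fun x hx => ?_)
            have hx0 : x ≠ 0 := fun h => by
              rw [h, mem_sphere_zero_iff_norm, norm_zero] at hx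
              exact hR.ne hx
            simp only [zmon, Fin.prod_univ_succAbove _ k, Fin.insertNth_apply_same,
              Fin.insertNth_apply_succAbove, hm, zpow_natCast, sub_zero, div_self hx0]
            ring
        _ = 0 := by rw [integral_const_mul, h1, mul_zero]
    · rw [differentiable_pi]
      intro j
      refine Fin.succAboveCases k ?_ (fun l => ?_) j <;> simp
    · rw [mem_closedBall_zero_iff] at hx
      rw [mem_closedBall_zero_iff, pi_norm_le_iff_of_nonneg hR.le]
      intro j
      refine Fin.succAboveCases k ?_ (fun l => ?_) j
      · simpa using hx
      · simpa using (mem_torusSet.1 hy l).le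

section

/-! ### Multiple geometric series -/

theorem summable_geometric_pi {n : ℕ} {t : Fin n → ℝ} (h0 : ∀ k, 0 ≤ t k) (h1 : ∀ k, t k < 1) :
    Summable fun P : Fin n → ℕ => ∏ k, t k ^ P k := by
  induction n with
  | zero => exact (hasSum_fintype _).summable
  | succ n ih =>
    rw [← (Fin.consEquiv fun _ : Fin (n + 1) => ℕ).summable_iff]
    refine ((summable_geometric_of_lt_one (h0 0) (h1 0)).mul_of_nonneg
      (ih (t := fun k => t k.succ) (fun k => h0 _) fun k => h1 _) (fun m => pow_nonneg (h0 0) m)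
      fun P => Finset.prod_nonneg fun k _ => pow_nonneg (h0 _) _).congr fun p => ?_
    simp [Fin.consEquiv, Fin.prod_univ_succ]

theorem hasSum_geometric_pi {n : ℕ} {z : Fin n → ℂ} (h1 : ∀ k, ‖z k‖ < 1) :
    HasSum (fun P : Fin n → ℕ => ∏ k, z k ^ P k) (∏ k, (1 - z k)⁻¹) := by
  induction n with
  | zero => simp
  | succ n ih =>
    rw [← (Fin.consEquiv fun _ : Fin (n + 1) => ℕ).hasSum_iff, Fin.prod_univ_succ]
    have hs : Summable fun p : ℕ × (Fin n → ℕ) => z 0 ^ p.1 * ∏ k, z k.succ ^ p.2 k := by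
      refine summable_mul_of_summable_norm (f := fun m : ℕ => z 0 ^ m)
        (g := fun P : Fin n → ℕ => ∏ k, z k.succ ^ P k) ?_ ?_
      · simpa using summable_geometric_of_lt_one (norm_nonneg _) (h1 0)
      · simpa using summable_geometric_pi (t := fun k => ‖z k.succ‖) (fun k => norm_nonneg _)
          fun k => h1 _
    convert! (hasSum_geometric_of_norm_lt_one (h1 0)).mul
      (ih (z := fun k => z k.succ) fun k => h1 _) hs using 1
    funext p
    simp [Fin.consEquiv, Fin.prod_univ_succ]

/-- Pairs of multiindices. -/
abbrev Idx (n : ℕ) : Type := (Fin n → ℕ) × (Fin n → ℕ)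

theorem summable_geometric_idx (n : ℕ) {t : ℝ} (h0 : 0 ≤ t) (h1 : t < 1) :
    Summable fun i : Idx n => t ^ (deg i.1 + deg i.2) := by
  have h := summable_geometric_pi (t := fun _ : Fin n => t) (fun _ => h0) fun _ => h1
  refine (h.mul_of_nonneg h (fun P => Finset.prod_nonneg fun k _ => pow_nonneg h0 _)
    fun P => Finset.prod_nonneg fun k _ => pow_nonneg h0 _).congr fun i => ?_
  simp only [Finset.prod_pow_eq_pow_sum, pow_add, deg]

/-! ### Integration over products of two tori -/

/-- The normalized measure on the product of two tori. -/
abbrev torus2 (n : ℕ) (R : ℝ) : Measure ((Fin n → ℂ) × (Fin n → ℂ)) :=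
  (torus n R).prod (torus n R)

/-- The product of two tori. -/
abbrev torusSet2 (n : ℕ) (R : ℝ) : Set ((Fin n → ℂ) × (Fin n → ℂ)) :=
  torusSet n R ×ˢ torusSet n R

theorem isCompact_torusSet2 (n : ℕ) (R : ℝ) : IsCompact (torusSet2 n R) :=
  (isCompact_torusSet n R).prod (isCompact_torusSet n R)

variable {n : ℕ} {R : ℝ}

theorem ae_torus2 (hR : 0 ≤ R) : ∀ᵐ p ∂torus2 n R, p ∈ torusSet2 n R := by
  filter_upwards [Measure.quasiMeasurePreserving_fst.ae (ae_torus hR),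
    Measure.quasiMeasurePreserving_snd.ae (ae_torus hR)] with p h1 h2 using ⟨h1, h2⟩

theorem integrable_torus2 (hR : 0 ≤ R) {f : (Fin n → ℂ) × (Fin n → ℂ) → ℂ}
    (hf : ContinuousOn f (torusSet2 n R)) : Integrable f (torus2 n R) :=
  integrable_of_continuousOn (isCompact_torusSet2 n R) (ae_torus2 hR) hf

theorem hasSum_integral_torus2 {ι : Type*} [Countable ι] (hR : 0 ≤ R)
    {f : ι → (Fin n → ℂ) × (Fin n → ℂ) → ℂ} {g : (Fin n → ℂ) × (Fin n → ℂ) → ℂ} {b : ι → ℝ}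
    (hf : ∀ i, ContinuousOn (f i) (torusSet2 n R)) (hb : ∀ i, ∀ p ∈ torusSet2 n R, ‖f i p‖ ≤ b i)
    (hs : Summable b) (hg : ∀ p ∈ torusSet2 n R, HasSum (fun i => f i p) (g p)) :
    HasSum (fun i => ∫ p, f i p ∂torus2 n R) (∫ p, g p ∂torus2 n R) :=
  hasSum_integral_of_dominated_convergence (fun i _ => b i)
    (fun i => (integrable_torus2 hR (hf i)).aestronglyMeasurable)
    (fun i => (ae_torus2 hR).mono fun p hp => hb i p hp)
    (Filter.Eventually.of_forall fun _ => hs) (integrable_const _)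
    ((ae_torus2 hR).mono fun p hp => hg p hp)

/-- Laurent coefficients of a function on the product of two tori. -/
def laurentCoeff (R : ℝ) (F : (Fin n → ℂ) × (Fin n → ℂ) → ℂ) (A B : Fin n → ℤ) : ℂ :=
  ∫ p, F p * (zmon (-A) p.1 * zmon (-B) p.2) ∂torus2 n R

/-- A multiindex of natural numbers as a multiindex of integers. -/
def intIdx (P : Fin n → ℕ) : Fin n → ℤ := fun k => P k

theorem zmon_intIdx (P : Fin n → ℕ) (z : Fin n → ℂ) : zmon (intIdx P) z = ∏ k, z k ^ P k := by
  simp [zmon, intIdx]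

theorem sum_intIdx (P : Fin n → ℕ) : ∑ k, intIdx P k = deg P := by simp [intIdx, deg]

theorem intIdx_injective : Function.Injective (intIdx (n := n)) := fun P Q h => by
  funext k
  simpa [intIdx] using congrFun h k

theorem continuousOn_zmon_mul_zmon (hR : 0 < R) (A B : Fin n → ℤ) :
    ContinuousOn (fun p : (Fin n → ℂ) × (Fin n → ℂ) => zmon A p.1 * zmon B p.2)
      (torusSet2 n R) :=
  ((continuousOn_zmon hR A).comp continuousOn_fst fun _ hp => hp.1).mul
    ((continuousOn_zmon hR B).comp continuousOn_snd fun _ hp => hp.2)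

theorem laurentCoeff_swap (F : (Fin n → ℂ) × (Fin n → ℂ) → ℂ) (A B : Fin n → ℤ) :
    laurentCoeff R (fun p => F p.swap) B A = laurentCoeff R F A B := by
  unfold laurentCoeff
  rw [← integral_prod_swap]
  refine integral_congr_ae (Filter.Eventually.of_forall fun p => ?_)
  simp only [Prod.fst_swap, Prod.snd_swap, Prod.swap_swap]
  ring

theorem laurentCoeff_congr (hR : 0 ≤ R) {F G : (Fin n → ℂ) × (Fin n → ℂ) → ℂ}
    (h : ∀ p ∈ torusSet2 n R, F p = G p) (A B : Fin n → ℤ) :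
    laurentCoeff R F A B = laurentCoeff R G A B :=
  integral_congr_ae ((ae_torus2 hR).mono fun p hp => by simp only [h p hp])

theorem zmon_neg_mul (hR : 0 < R) (A B : Fin n → ℤ) {z : Fin n → ℂ} (hz : z ∈ torusSet n R) :
    zmon B z * zmon (-A) z = zmon (-(A - B)) z := by
  rw [← zmon_add _ _ (ne_zero_of_mem_torusSet hR hz), neg_sub, sub_eq_add_neg]

theorem laurentCoeff_zmon_mul (hR : 0 < R) (F : (Fin n → ℂ) × (Fin n → ℂ) → ℂ)
    (A B A' B' : Fin n → ℤ) :
    laurentCoeff R (fun p => F p * (zmon A' p.1 * zmon B' p.2)) A B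
      = laurentCoeff R F (A - A') (B - B') := by
  refine integral_congr_ae ((ae_torus2 hR.le).mono fun p hp => ?_)
  simp only [← zmon_neg_mul hR _ _ hp.1, ← zmon_neg_mul hR _ _ hp.2]
  ring

/-- The inner integral over `u` already vanishes for each `v` on the torus, so holomorphy in `v` is
not needed. -/
theorem laurentCoeff_eq_zero_of_neg (hR : 0 < R) {F : (Fin n → ℂ) × (Fin n → ℂ) → ℂ}
    (hc : ContinuousOn F (torusSet2 n R))
    (hF : ∀ v ∈ torusSet n R, DifferentiableOn ℂ (fun u => F (u, v)) (Metric.closedBall 0 R))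
    {A : Fin n → ℤ} (B : Fin n → ℤ) {k : Fin n} (hk : A k < 0) : laurentCoeff R F A B = 0 := by
  unfold laurentCoeff
  rw [integral_prod_symm _ (integrable_torus2 hR.le (hc.fun_mul (continuousOn_zmon_mul_zmon hR _ _)))]
  refine integral_eq_zero_of_ae ((ae_torus hR.le).mono fun v hv => ?_)
  have := integral_torus_mul_zmon_eq_zero hR (hF v hv) (A := -A) (k := k) (by simpa using hk)
  simp only [← mul_assoc]
  rw [integral_mul_const, this, zero_mul]
  rfl

/-- The mean value property in `u`: Cauchy's formula at the centre. -/
theorem laurentCoeff_zero_left (hR : 0 < R) {F : (Fin n → ℂ) × (Fin n → ℂ) → ℂ}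
    (hc : ContinuousOn F (torusSet2 n R))
    (hF : ∀ v ∈ torusSet n R, DifferentiableOn ℂ (fun u => F (u, v)) (Metric.closedBall 0 R))
    (B : Fin n → ℤ) : laurentCoeff R F 0 B = ∫ v, F (0, v) * zmon (-B) v ∂torus n R := by
  unfold laurentCoeff
  rw [integral_prod_symm _ (integrable_torus2 hR.le (hc.fun_mul (continuousOn_zmon_mul_zmon hR _ _)))]
  refine integral_congr_ae ((ae_torus hR.le).mono fun v hv => ?_)
  have := integral_torus_cauchy hR (hF v hv) (w := 0) (fun _ => by simpa using hR)
  simp only [neg_zero, zmon_zero, one_mul]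
  rw [integral_mul_const, ← this]
  congr 1
  refine integral_congr_ae ((ae_torus hR.le).mono fun u hu => ?_)
  simp [div_self (ne_zero_of_mem_torusSet hR hu _)]

theorem integral_circ_zpow (hR : 0 < R) {m : ℤ} (hm : m ≠ 0) : ∫ z, z ^ m ∂circ R = 0 := by
  have hne : ∀ z ∈ Metric.sphere (0 : ℂ) R, z ≠ 0 := fun z hz h => by
    rw [h, mem_sphere_zero_iff_norm, norm_zero] at hz
    exact hR.ne hz
  rw [integral_circ (integrable_circ hR.le (ContinuousOn.zpow₀ (f := fun z => z) continuousOn_id m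
      fun z hz => Or.inl (hne z hz))).aestronglyMeasurable,
    Real.circleAverage_eq_circleIntegral hR.ne',
    circleIntegral.integral_congr (g := fun z => (z - 0) ^ (m - 1)) hR.le fun z hz => ?_,
    circleIntegral.integral_sub_zpow_of_ne (by omega), smul_zero]
  simp only [sub_zero, smul_eq_mul]
  rw [zpow_sub₀ (hne z hz), zpow_one, div_eq_mul_inv, mul_comm]

theorem integral_torus_zmon (hR : 0 < R) (A : Fin n → ℤ) :
    ∫ z, zmon A z ∂torus n R = if A = 0 then 1 else 0 := by
  split_ifs with h
  · simp [h, zmon_zero]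
  · obtain ⟨k, hk⟩ := Function.ne_iff.1 h
    unfold zmon
    rw [integral_fintype_prod_eq_prod (fun k (z : ℂ) => z ^ A k)]
    exact Finset.prod_eq_zero (Finset.mem_univ k) (integral_circ_zpow hR hk)

/-- Cauchy's estimate. -/
theorem norm_laurentCoeff_le (hR : 0 < R) {F : (Fin n → ℂ) × (Fin n → ℂ) → ℂ} {M : ℝ}
    (hM : ∀ p ∈ torusSet2 n R, ‖F p‖ ≤ M) (P Q : Fin n → ℕ) :
    ‖laurentCoeff R F (intIdx P) (intIdx Q)‖ ≤ M * R⁻¹ ^ (deg P + deg Q) := by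
  have h : ∀ᵐ p ∂torus2 n R, ‖F p * (zmon (-intIdx P) p.1 * zmon (-intIdx Q) p.2)‖
      ≤ M * R⁻¹ ^ (deg P + deg Q) := (ae_torus2 hR.le).mono fun p hp => by
    rw [norm_mul, norm_mul, norm_zmon _ hp.1, norm_zmon _ hp.2]
    have e : ∀ P : Fin n → ℕ, ∏ k, R ^ (-intIdx P) k = R⁻¹ ^ deg P := fun P => by
      simp [intIdx, deg, Finset.prod_pow_eq_pow_sum]
    rw [e, e, ← pow_add]
    exact mul_le_mul_of_nonneg_right (hM p hp) (by positivity)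
  simpa [laurentCoeff] using norm_integral_le_of_norm_le_const h

/-! ### Cauchy kernels and power series of entire functions -/

theorem summable_kernel (hR : 0 < R) {x : Fin n → ℂ} (hx : ∀ k, ‖x k‖ < R) :
    Summable fun P : Fin n → ℕ => ∏ k, (‖x k‖ / R) ^ P k :=
  summable_geometric_pi (fun k => by positivity) fun k => (div_lt_one hR).2 (hx k)

theorem norm_kernel {x u : Fin n → ℂ} (hu : u ∈ torusSet n R) (P : Fin n → ℕ) :
    ‖zmon (intIdx P) x * zmon (-intIdx P) u‖ = ∏ k, (‖x k‖ / R) ^ P k := by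
  rw [norm_mul, norm_zmon _ hu, zmon_intIdx, norm_prod, ← Finset.prod_mul_distrib]
  refine Finset.prod_congr rfl fun k _ => ?_
  simp [intIdx, div_pow, ← div_eq_mul_inv]

/-- Geometric series of `u / (u - x) = 1 / (1 - x / u)` in each coordinate. -/
theorem hasSum_kernel (hR : 0 < R) {x u : Fin n → ℂ} (hx : ∀ k, ‖x k‖ < R)
    (hu : u ∈ torusSet n R) :
    HasSum (fun P : Fin n → ℕ => zmon (intIdx P) x * zmon (-intIdx P) u)
      (∏ k, u k / (u k - x k)) := by
  have hu0 := ne_zero_of_mem_torusSet hR hu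
  convert! hasSum_geometric_pi (z := fun k => x k / u k) fun k => ?_ using 1
  · funext P
    simp only [zmon, ← Finset.prod_mul_distrib]
    refine Finset.prod_congr rfl fun k _ => ?_
    simp [intIdx, div_pow, ← div_eq_mul_inv]
  · refine Finset.prod_congr rfl fun k _ => ?_
    rw [one_sub_div (hu0 k), inv_div]
  · rw [norm_div, mem_torusSet.1 hu k, div_lt_one hR]
    exact hx k

theorem hasSum_mul_of_summable_norm {ι κ : Type*} {f : ι → ℂ} {g : κ → ℂ} {a b : ℂ}
    (hf : HasSum f a) (hg : HasSum g b) (hf' : Summable fun i => ‖f i‖)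
    (hg' : Summable fun j => ‖g j‖) : HasSum (fun i : ι × κ => f i.1 * g i.2) (a * b) :=
  hf.mul hg (summable_mul_of_summable_norm hf' hg')

theorem hasSum_kernel_mul_kernel (hR : 0 < R) {x y u v : Fin n → ℂ} (hx : ∀ k, ‖x k‖ < R)
    (hy : ∀ k, ‖y k‖ < R) (hu : u ∈ torusSet n R) (hv : v ∈ torusSet n R) :
    HasSum (fun i : Idx n => (zmon (intIdx i.1) x * zmon (-intIdx i.1) u) *
      (zmon (intIdx i.2) y * zmon (-intIdx i.2) v))
      ((∏ k, u k / (u k - x k)) * ∏ k, v k / (v k - y k)) := by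
  have h1 : Summable fun P : Fin n → ℕ => ‖zmon (intIdx P) x * zmon (-intIdx P) u‖ := by
    simpa only [norm_kernel hu] using summable_kernel hR hx
  have h2 : Summable fun P : Fin n → ℕ => ‖zmon (intIdx P) y * zmon (-intIdx P) v‖ := by
    simpa only [norm_kernel hv] using summable_kernel hR hy
  have h3 := hasSum_mul_of_summable_norm (hasSum_kernel hR hx hu) (hasSum_kernel hR hy hv) h1 h2
  exact h3

theorem continuousOn_kernel {x : Fin n → ℂ} (hx : ∀ k, ‖x k‖ < R) :
    ContinuousOn (fun u : Fin n → ℂ => ∏ k, u k / (u k - x k)) (torusSet n R) :=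
  continuousOn_finsetProd _ fun k _ => ContinuousOn.div (by fun_prop) (by fun_prop)
    fun z hz h => by
      have := mem_torusSet.1 hz k
      rw [sub_eq_zero.1 h] at this
      exact (hx k).ne this

theorem integral_torus2_cauchy (hR : 0 < R) {G : (Fin n → ℂ) × (Fin n → ℂ) → ℂ}
    (hG : Differentiable ℂ G) {x y : Fin n → ℂ} (hx : ∀ k, ‖x k‖ < R) (hy : ∀ k, ‖y k‖ < R) :
    ∫ p, ((∏ k, p.1 k / (p.1 k - x k)) * ∏ k, p.2 k / (p.2 k - y k)) * G p ∂torus2 n R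
      = G (x, y) := by
  have hc : ContinuousOn (fun p : (Fin n → ℂ) × (Fin n → ℂ) => ((∏ k, p.1 k / (p.1 k - x k)) *
      ∏ k, p.2 k / (p.2 k - y k)) * G p) (torusSet2 n R) :=
    ((ContinuousOn.comp (continuousOn_kernel hx) continuousOn_fst fun _ hp => hp.1).fun_mul
      (ContinuousOn.comp (continuousOn_kernel hy) continuousOn_snd fun _ hp => hp.2)).fun_mul
        hG.continuous.continuousOn
  rw [integral_prod _ (integrable_torus2 hR.le hc)]
  have h1 : ∀ u, ∫ v, ((∏ k, u k / (u k - x k)) * ∏ k, v k / (v k - y k)) * G (u, v) ∂torus n R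
      = (∏ k, u k / (u k - x k)) * G (u, y) := fun u => by
    simp only [mul_assoc]
    rw [integral_const_mul, integral_torus_cauchy hR (f := fun v => G (u, v))
      (hG.comp (by fun_prop : Differentiable ℂ fun v => (u, v))).differentiableOn hy]
  simp only [h1]
  exact integral_torus_cauchy hR (f := fun u => G (u, y))
    (hG.comp (by fun_prop : Differentiable ℂ fun u => (u, y))).differentiableOn hx

/-- The power series expansion of an entire function. -/
theorem hasSum_laurentCoeff (hR : 0 < R) {G : (Fin n → ℂ) × (Fin n → ℂ) → ℂ}
    (hG : Differentiable ℂ G) {x y : Fin n → ℂ} (hx : ∀ k, ‖x k‖ < R) (hy : ∀ k, ‖y k‖ < R) :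
    HasSum (fun i : Idx n => laurentCoeff R G (intIdx i.1) (intIdx i.2) *
      (zmon (intIdx i.1) x * zmon (intIdx i.2) y)) (G (x, y)) := by
  obtain ⟨M, hM⟩ := (isCompact_torusSet2 n R).exists_bound_of_continuousOn
    hG.continuous.continuousOn
  rw [← integral_torus2_cauchy hR hG hx hy]
  have hc : ∀ i : Idx n, ContinuousOn (fun p : (Fin n → ℂ) × (Fin n → ℂ) =>
      ((zmon (intIdx i.1) x * zmon (-intIdx i.1) p.1) *
      (zmon (intIdx i.2) y * zmon (-intIdx i.2) p.2)) * G p) (torusSet2 n R) := fun i =>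
    ((continuousOn_const.fun_mul (ContinuousOn.comp (continuousOn_zmon hR _) continuousOn_fst
      fun _ hp => hp.1)).fun_mul (continuousOn_const.fun_mul (ContinuousOn.comp
        (continuousOn_zmon hR _) continuousOn_snd fun _ hp => hp.2))).fun_mul
          hG.continuous.continuousOn
  have hpos : ∀ (x : Fin n → ℂ) (P : Fin n → ℕ), 0 ≤ ∏ k, (‖x k‖ / R) ^ P k := fun x P =>
    Finset.prod_nonneg fun k _ => by positivity
  have hb : ∀ i : Idx n, ∀ p ∈ torusSet2 n R, ‖((zmon (intIdx i.1) x * zmon (-intIdx i.1) p.1) *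
      (zmon (intIdx i.2) y * zmon (-intIdx i.2) p.2)) * G p‖ ≤
      ((∏ k, (‖x k‖ / R) ^ i.1 k) * ∏ k, (‖y k‖ / R) ^ i.2 k) * M := fun i p hp => by
    rw [norm_mul, norm_mul, norm_kernel hp.1, norm_kernel hp.2]
    exact mul_le_mul_of_nonneg_left (hM p hp) (mul_nonneg (hpos _ _) (hpos _ _))
  have hs := ((summable_kernel hR hx).mul_of_nonneg (summable_kernel hR hy) (hpos x)
    (hpos y)).mul_right M
  -- Expand both Cauchy kernels and integrate term by term; the bound on each term is constant on
  -- the tori, so dominated convergence applies.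
  have key := hasSum_integral_torus2 hR.le hc hb hs
    fun p hp => (hasSum_kernel_mul_kernel hR hx hy hp.1 hp.2).mul_right (G p)
  refine key.congr_fun fun i => ?_
  rw [laurentCoeff, ← integral_mul_const]
  refine integral_congr_ae (Filter.Eventually.of_forall fun p => ?_)
  simp only
  ring

/-! ### Powers of `1 + ∑ κ_k u_k v_k` -/

/-- The polynomial `1 + ∑ κ_k u_k v_k`. -/
def quadric (κ : Fin n → ℂ) (p : (Fin n → ℂ) × (Fin n → ℂ)) : ℂ := 1 + ∑ k, κ k * p.1 k * p.2 k

theorem differentiable_quadric (κ : Fin n → ℂ) : Differentiable ℂ (quadric κ) := by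
  unfold quadric
  fun_prop

theorem continuous_quadric (κ : Fin n → ℂ) : Continuous (quadric κ) :=
  (differentiable_quadric κ).continuous

theorem norm_quadric_ge (κ : Fin n → ℂ) {p : (Fin n → ℂ) × (Fin n → ℂ)} (h1 : ∀ k, ‖p.1 k‖ ≤ R)
    (h2 : ∀ k, ‖p.2 k‖ ≤ R) : 1 - (∑ k, ‖κ k‖) * R ^ 2 ≤ ‖quadric κ p‖ := by
  have h : ‖∑ k, κ k * p.1 k * p.2 k‖ ≤ (∑ k, ‖κ k‖) * R ^ 2 := by
    rw [Finset.sum_mul]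
    refine (norm_sum_le _ _).trans (Finset.sum_le_sum fun k _ => ?_)
    rw [norm_mul, norm_mul, mul_assoc, sq]
    exact mul_le_mul_of_nonneg_left (mul_le_mul (h1 k) (h2 k) (norm_nonneg _)
      ((norm_nonneg _).trans (h1 k))) (norm_nonneg _)
  have h' := norm_sub_norm_le (1 : ℂ) (-∑ k, κ k * p.1 k * p.2 k)
  rw [norm_one, norm_neg, sub_neg_eq_add] at h'
  unfold quadric
  linarith

theorem quadric_ne_zero {κ : Fin n → ℂ} (hκ : (∑ k, ‖κ k‖) * R ^ 2 < 1)
    {p : (Fin n → ℂ) × (Fin n → ℂ)} (h1 : ∀ k, ‖p.1 k‖ ≤ R) (h2 : ∀ k, ‖p.2 k‖ ≤ R) :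
    quadric κ p ≠ 0 := fun h => by
  have := norm_quadric_ge κ h1 h2
  rw [h, norm_zero] at this
  linarith

theorem quadric_ne_zero_of_mem {κ : Fin n → ℂ} (hκ : (∑ k, ‖κ k‖) * R ^ 2 < 1)
    {p : (Fin n → ℂ) × (Fin n → ℂ)} (hp : p ∈ torusSet2 n R) : quadric κ p ≠ 0 :=
  quadric_ne_zero hκ (fun k => (mem_torusSet.1 hp.1 k).le) fun k => (mem_torusSet.1 hp.2 k).le

theorem laurentCoeff_one (hR : 0 < R) (A B : Fin n → ℤ) :
    laurentCoeff R (fun _ => 1) A B = if A = 0 ∧ B = 0 then 1 else 0 := by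
  simp only [laurentCoeff, one_mul]
  rw [integral_prod_mul, integral_torus_zmon hR, integral_torus_zmon hR]
  simp only [neg_eq_zero]
  by_cases hA : A = 0 <;> by_cases hB : B = 0 <;> simp [hA, hB]

/-- The monomials `u^A v^B` in the expansion of `(1 + ∑ κ_k u_k v_k) ^ N` have `A = B` and degree
at most `N`. -/
theorem laurentCoeff_quadric_pow_eq_zero (hR : 0 < R) (κ : Fin n → ℂ) (N : ℕ) {A B : Fin n → ℤ}
    (h : ∀ E : Fin n → ℕ, deg E ≤ N → A = intIdx E → B = intIdx E → False) :
    laurentCoeff R (fun p => quadric κ p ^ N) A B = 0 := by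
  induction N generalizing A B with
  | zero =>
    simp only [pow_zero]
    rw [laurentCoeff_one hR, if_neg]
    rintro ⟨rfl, rfl⟩
    exact h 0 (by simp [deg]) (by ext; simp [intIdx]) (by ext; simp [intIdx])
  | succ N ih =>
    have hint : ∀ A' B' : Fin n → ℤ, Integrable (fun p : (Fin n → ℂ) × (Fin n → ℂ) =>
        quadric κ p ^ N * (zmon A' p.1 * zmon B' p.2)) (torus2 n R) := fun A' B' =>
      integrable_torus2 hR.le (((continuous_quadric κ).pow N).continuousOn.mul
        (continuousOn_zmon_mul_zmon hR A' B'))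
    -- Multiplication by the quadric either leaves the exponents alone or raises `A` and `B` by the
    -- same unit vector.
    have key : laurentCoeff R (fun p => quadric κ p ^ (N + 1)) A B =
        laurentCoeff R (fun p => quadric κ p ^ N) A B +
          ∑ k, κ k * laurentCoeff R (fun p => quadric κ p ^ N) (A - Pi.single k 1)
            (B - Pi.single k 1) := by
      simp only [laurentCoeff, ← integral_const_mul]
      rw [← integral_finsetSum _ fun k _ => (hint _ _).const_mul (κ k),
        ← integral_add (hint _ _) (integrable_finsetSum _ fun k _ => (hint _ _).const_mul (κ k))]
      refine integral_congr_ae ((ae_torus2 hR.le).mono fun p hp => ?_)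
      have e : ∀ (k : Fin n) (z : Fin n → ℂ), zmon (Pi.single k 1) z = z k := fun k z => by
        rw [zmon, Finset.prod_eq_single k (fun j _ hj => by simp [hj]) (by simp)]
        simp
      simp only [← zmon_neg_mul hR _ _ hp.1, ← zmon_neg_mul hR _ _ hp.2, e, pow_succ]
      generalize quadric κ p ^ N = X
      rw [quadric]
      rw [mul_add, mul_one, add_mul, Finset.mul_sum, Finset.sum_mul]
      refine congrArg₂ _ rfl (Finset.sum_congr rfl fun k _ => ?_)
      ring
    rw [key, ih fun E hE => h E (by omega), zero_add]
    refine Finset.sum_eq_zero fun k _ => ?_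
    rw [ih, mul_zero]
    intro E hE hA hB
    have hs : intIdx (E + Pi.single k 1) = intIdx E + Pi.single k 1 := by
      ext j
      by_cases hj : j = k
      · subst hj; simp [intIdx]
      · simp [intIdx, hj]
    refine h (E + Pi.single k 1) ?_ ?_ ?_
    · have : deg (E + Pi.single k 1) = deg E + 1 := by
        simp [deg, Finset.sum_add_distrib]
      omega
    · rw [hs, ← hA, sub_add_cancel]
    · rw [hs, ← hB, sub_add_cancel]

theorem continuousOn_quadric_zpow {κ : Fin n → ℂ} (hκ : (∑ k, ‖κ k‖) * R ^ 2 < 1) (N : ℤ) :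
    ContinuousOn (fun p => quadric κ p ^ N) (torusSet2 n R) :=
  (continuous_quadric κ).continuousOn.zpow₀ N fun _ hp => Or.inl (quadric_ne_zero_of_mem hκ hp)

theorem differentiableOn_quadric_zpow {κ : Fin n → ℂ} (hR : 0 ≤ R)
    (hκ : (∑ k, ‖κ k‖) * R ^ 2 < 1) (N : ℤ) {v : Fin n → ℂ} (hv : v ∈ torusSet n R) :
    DifferentiableOn ℂ (fun u => quadric κ (u, v) ^ N) (Metric.closedBall 0 R) := by
  refine DifferentiableOn.zpow ((differentiable_quadric κ).comp
    (by fun_prop : Differentiable ℂ fun u : Fin n → ℂ => (u, v))).differentiableOn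
      (Or.inl fun u hu => quadric_ne_zero hκ ?_ fun k => (mem_torusSet.1 hv k).le)
  rw [mem_closedBall_zero_iff, pi_norm_le_iff_of_nonneg hR] at hu
  exact hu

/-- The orthogonality relation behind the integral formula. -/
theorem laurentCoeff_quadric_zpow (hR : 0 < R) {κ : Fin n → ℂ} (hκ : (∑ k, ‖κ k‖) * R ^ 2 < 1)
    (i j : Idx n) :
    laurentCoeff R (fun p => quadric κ p ^ ((deg i.1 : ℤ) - 1 - deg j.1))
      (intIdx i.1 - intIdx j.1) (intIdx i.2 - intIdx j.2) = if j = i then 1 else 0 := by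
  -- For an exponent `N ≥ 0` the power is a polynomial of degree at most `N` in `u`, while the
  -- multiindex asked for has degree `N + 1`: the coefficient is zero. The shift by `-1` in the
  -- exponent is essential here.
  rcases le_or_gt (0 : ℤ) ((deg i.1 : ℤ) - 1 - deg j.1) with hN | hN
  · obtain ⟨N, hN'⟩ : ∃ N : ℕ, (deg i.1 : ℤ) - 1 - deg j.1 = N := ⟨_, (Int.toNat_of_nonneg hN).symm⟩
    rw [if_neg (fun h => by rw [h] at hN; omega)]
    simp only [hN', zpow_natCast]
    refine laurentCoeff_quadric_pow_eq_zero hR κ N fun E hE hA _ => ?_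
    have := congrArg (fun A : Fin n → ℤ => ∑ k, A k) hA
    simp only [Pi.sub_apply, Finset.sum_sub_distrib, sum_intIdx] at this
    omega
  -- Now `|i.1| ≤ |j.1|`. So either `j.1 = i.1`, and setting `u = 0` turns the power into `1`, or
  -- some exponent in `u` is negative, and holomorphy in `u` gives zero.
  · by_cases hle : ∀ k, j.1 k ≤ i.1 k
    · have h1 : j.1 = i.1 := by
        have hs : ∑ k, (i.1 k - j.1 k) = 0 := by
          have : ∑ k, (i.1 k - j.1 k) + deg j.1 = deg i.1 := by
            simp only [deg, ← Finset.sum_add_distrib]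
            exact Finset.sum_congr rfl fun k _ => Nat.sub_add_cancel (hle k)
          omega
        funext k
        have := Finset.sum_eq_zero_iff.1 hs k (Finset.mem_univ k)
        have := hle k
        omega
      rw [h1, sub_self, laurentCoeff_zero_left hR (continuousOn_quadric_zpow hκ _)
        fun v hv => differentiableOn_quadric_zpow hR.le hκ _ hv]
      have e : ∀ v : Fin n → ℂ, quadric κ (0, v) = 1 := fun v => by simp [quadric]
      simp only [e, one_zpow, one_mul]
      rw [integral_torus_zmon hR]
      refine if_congr ?_ rfl rfl
      rw [neg_eq_zero, sub_eq_zero, Prod.ext_iff, intIdx_injective.eq_iff]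
      exact ⟨fun h => ⟨h1, h.symm⟩, fun h => h.2.symm⟩
    · push Not at hle
      obtain ⟨k, hk⟩ := hle
      rw [if_neg (fun h => by rw [h] at hk; exact lt_irrefl _ hk)]
      exact laurentCoeff_eq_zero_of_neg hR (continuousOn_quadric_zpow hκ _)
        (fun v hv => differentiableOn_quadric_zpow hR.le hκ _ hv) _ (k := k)
        (by simp only [Pi.sub_apply, intIdx]; omega)

/-! ### Taylor coefficients under the substitution `x = u / c`, `y = v` -/

theorem zmon_intIdx_smul (P : Fin n → ℕ) (a : ℂ) (z : Fin n → ℂ) :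
    zmon (intIdx P) (a • z) = a ^ deg P * zmon (intIdx P) z := by
  simp only [zmon_intIdx, Pi.smul_apply, smul_eq_mul, mul_pow, Finset.prod_mul_distrib,
    Finset.prod_pow_eq_pow_sum, deg]

theorem norm_zmon_intIdx_le {t : ℝ} {z : Fin n → ℂ} (hz : ∀ k, ‖z k‖ ≤ t) (P : Fin n → ℕ) :
    ‖zmon (intIdx P) z‖ ≤ t ^ deg P := by
  rw [zmon_intIdx, norm_prod, deg, ← Finset.prod_pow_eq_pow_sum]
  refine Finset.prod_le_prod (fun _ _ => norm_nonneg _) fun k _ => ?_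
  rw [norm_pow]
  exact pow_le_pow_left₀ (norm_nonneg _) (hz k) _

/-- The power series coefficients of an entire function `G` can be computed by integrating
`G (u / c, v)`, where `c = 1 + ∑ κ_k u_k v_k`. -/
theorem laurentCoeff_comp_quadric (hR : 0 < R) {κ : Fin n → ℂ} (hκ : (∑ k, ‖κ k‖) * R ^ 2 < 1)
    {G : (Fin n → ℂ) × (Fin n → ℂ) → ℂ} (hG : Differentiable ℂ G) {ρ : ℝ}
    (hρ : R / (1 - (∑ k, ‖κ k‖) * R ^ 2) < ρ) (i : Idx n) :
    laurentCoeff R (fun p => G ((quadric κ p)⁻¹ • p.1, p.2) * quadric κ p ^ ((deg i.1 : ℤ) - 1))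
      (intIdx i.1) (intIdx i.2) = laurentCoeff ρ G (intIdx i.1) (intIdx i.2) := by
  -- On the tori `|c| ≥ 1 - (∑ |κ_k|) R²`, so `R₁` bounds the coordinates of `u / c`. The Taylor
  -- series, taken on the larger radius `ρ`, thus converges there uniformly.
  set R₁ := R / (1 - (∑ k, ‖κ k‖) * R ^ 2) with hR₁
  have hpos : 0 < 1 - (∑ k, ‖κ k‖) * R ^ 2 := by linarith
  have hR₁pos : 0 < R₁ := div_pos hR hpos
  have hρ0 : 0 < ρ := hR₁pos.trans hρ
  have hRR₁ : R ≤ R₁ := by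
    rw [hR₁, le_div_iff₀ hpos]
    have : 0 ≤ (∑ k, ‖κ k‖) * R ^ 2 := mul_nonneg (Finset.sum_nonneg fun k _ => norm_nonneg _)
      (sq_nonneg R)
    nlinarith
  have hc : ∀ p ∈ torusSet2 n R, quadric κ p ≠ 0 := fun p hp => quadric_ne_zero_of_mem hκ hp
  have hu : ∀ p ∈ torusSet2 n R, ∀ k, ‖((quadric κ p)⁻¹ • p.1) k‖ ≤ R₁ := fun p hp k => by
    rw [Pi.smul_apply, smul_eq_mul, norm_mul, norm_inv, mem_torusSet.1 hp.1 k, hR₁,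
      div_eq_inv_mul]
    refine mul_le_mul_of_nonneg_right (inv_anti₀ hpos (norm_quadric_ge κ
      (fun k => (mem_torusSet.1 hp.1 k).le) fun k => (mem_torusSet.1 hp.2 k).le)) hR.le
  have hv : ∀ p ∈ torusSet2 n R, ∀ k, ‖p.2 k‖ ≤ R₁ := fun p hp k =>
    (mem_torusSet.1 hp.2 k).trans_le hRR₁
  obtain ⟨M, hM⟩ := (isCompact_torusSet2 n ρ).exists_bound_of_continuousOn
    hG.continuous.continuousOn
  set w : (Fin n → ℂ) × (Fin n → ℂ) → ℂ := fun p =>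
    quadric κ p ^ ((deg i.1 : ℤ) - 1) * (zmon (-intIdx i.1) p.1 * zmon (-intIdx i.2) p.2) with hw
  have hwc : ContinuousOn w (torusSet2 n R) :=
    (continuousOn_quadric_zpow hκ _).mul (continuousOn_zmon_mul_zmon hR _ _)
  obtain ⟨C, hC⟩ := (isCompact_torusSet2 n R).exists_bound_of_continuousOn hwc
  set a : Idx n → ℂ := fun j => laurentCoeff ρ G (intIdx j.1) (intIdx j.2) with ha
  have hb : ∀ j : Idx n, ∀ p ∈ torusSet2 n R,
      ‖a j * (zmon (intIdx j.1) ((quadric κ p)⁻¹ • p.1) * zmon (intIdx j.2) p.2) * w p‖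
        ≤ M * (R₁ / ρ) ^ (deg j.1 + deg j.2) * C := fun j p hp => by
    have hM0 : 0 ≤ M * ρ⁻¹ ^ (deg j.1 + deg j.2) :=
      (norm_nonneg _).trans (norm_laurentCoeff_le hρ0 hM _ _)
    have e : M * (R₁ / ρ) ^ (deg j.1 + deg j.2) * C
        = M * ρ⁻¹ ^ (deg j.1 + deg j.2) * (R₁ ^ deg j.1 * R₁ ^ deg j.2) * C := by
      rw [div_eq_mul_inv, mul_pow, pow_add R₁]
      ring
    rw [e, norm_mul, norm_mul, norm_mul]
    refine mul_le_mul (mul_le_mul (norm_laurentCoeff_le hρ0 hM _ _)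
      (mul_le_mul (norm_zmon_intIdx_le (hu p hp) _) (norm_zmon_intIdx_le (hv p hp) _)
        (norm_nonneg _) (by positivity)) (by positivity) hM0) (hC p hp) (norm_nonneg _)
          (mul_nonneg hM0 (by positivity))
  have hsum : ∀ p ∈ torusSet2 n R, HasSum (fun j : Idx n =>
      a j * (zmon (intIdx j.1) ((quadric κ p)⁻¹ • p.1) * zmon (intIdx j.2) p.2) * w p)
        (G ((quadric κ p)⁻¹ • p.1, p.2) * w p) := fun p hp =>
    (hasSum_laurentCoeff hρ0 hG (fun k => (hu p hp k).trans_lt hρ)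
      fun k => (hv p hp k).trans_lt hρ).mul_right _
  -- The `j`-th Taylor term contributes `c^(-|j.1|)`, which leaves the power of `c` in the
  -- orthogonality relation; only `j = i` survives integration.
  have hterm : ∀ j : Idx n, ∀ p ∈ torusSet2 n R,
      a j * (zmon (intIdx j.1) ((quadric κ p)⁻¹ • p.1) * zmon (intIdx j.2) p.2) * w p =
      a j * (quadric κ p ^ ((deg i.1 : ℤ) - 1 - deg j.1) *
        (zmon (-(intIdx i.1 - intIdx j.1)) p.1 * zmon (-(intIdx i.2 - intIdx j.2)) p.2)) :=
    fun j p hp => by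
      rw [zmon_intIdx_smul, ← zmon_neg_mul hR _ _ hp.1, ← zmon_neg_mul hR _ _ hp.2,
        zpow_sub₀ (hc p hp) _ (deg j.1 : ℤ), zpow_natCast, hw, inv_pow]
      simp only
      ring
  have hcont : ∀ j : Idx n, ContinuousOn (fun p => a j *
      (zmon (intIdx j.1) ((quadric κ p)⁻¹ • p.1) * zmon (intIdx j.2) p.2) * w p)
        (torusSet2 n R) := fun j =>
    ContinuousOn.congr (continuousOn_const.fun_mul ((continuousOn_quadric_zpow hκ _).fun_mul
      (continuousOn_zmon_mul_zmon hR _ _))) fun p hp => hterm j p hp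
  have key := hasSum_integral_torus2 hR.le hcont hb
    (((summable_geometric_idx n (by positivity) ((div_lt_one hρ0).2 hρ)).mul_left M).mul_right C)
    hsum
  have hval : ∀ j : Idx n, ∫ p, a j *
      (zmon (intIdx j.1) ((quadric κ p)⁻¹ • p.1) * zmon (intIdx j.2) p.2) * w p ∂torus2 n R
        = if j = i then a j else 0 := fun j => by
    rw [integral_congr_ae ((ae_torus2 hR.le).mono fun p hp => hterm j p hp), integral_const_mul]
    have := laurentCoeff_quadric_zpow hR hκ i j
    rw [laurentCoeff] at this
    rw [this, mul_ite, mul_one, mul_zero]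
  simp only [hval] at key
  have h2 : HasSum (fun j => if j = i then a j else 0) (a i) := by
    convert! hasSum_ite_eq i (a i) using 2 with j
    split_ifs with h
    · rw [h]
    · rfl
  rw [← ha] at *
  refine Eq.trans ?_ (key.unique h2)
  refine integral_congr_ae (Filter.Eventually.of_forall fun p => ?_)
  simp only [hw]
  ring

/-- The power series coefficients of an entire function do not depend on the radius. -/
theorem laurentCoeff_radius (hR : 0 < R) {ρ : ℝ} (hρ : 0 < ρ)
    {G : (Fin n → ℂ) × (Fin n → ℂ) → ℂ} (hG : Differentiable ℂ G) (i : Idx n) :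
    laurentCoeff R G (intIdx i.1) (intIdx i.2) = laurentCoeff ρ G (intIdx i.1) (intIdx i.2) := by
  have h : ∀ {R : ℝ}, 0 < R → ∀ {σ : ℝ}, R < σ → laurentCoeff R G (intIdx i.1) (intIdx i.2)
      = laurentCoeff σ G (intIdx i.1) (intIdx i.2) := fun {R} hR {σ} hσ => by
    -- For `κ = 0` the quadric is `1`, and the substitution formula just enlarges the radius.
    have := laurentCoeff_comp_quadric hR (κ := 0) (by simp) hG (ρ := σ) (by simpa using hσ) i
    simpa [quadric] using this
  rw [h hR (σ := max R ρ + 1) (by linarith [le_max_left R ρ]),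
    h hρ (σ := max R ρ + 1) (by linarith [le_max_right R ρ])]

end

/-! ### Uniqueness of Laurent series -/

/-- Fourier extraction: averaging against `z^(-m)` over the unit circle keeps only the terms of
degree `m`. -/
theorem hasSum_integral_circ_zpow {ι : Type*} [Countable ι] (d : ι → ℤ) {b : ι → ℂ}
    (hb : Summable b) (m : ℤ) :
    HasSum (fun i => if d i = m then b i else 0)
      (∫ z, (∑' i, b i * z ^ d i) * z ^ (-m) ∂circ 1) := by
  have hz : ∀ z ∈ Metric.sphere (0 : ℂ) 1, ‖z‖ = 1 := fun z hz => mem_sphere_zero_iff_norm.1 hz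
  have hz0 : ∀ z ∈ Metric.sphere (0 : ℂ) 1, z ≠ 0 := fun z h h0 => by simpa [h0] using hz z h
  have hn : ∀ i, ∀ z ∈ Metric.sphere (0 : ℂ) 1, ‖b i * z ^ d i * z ^ (-m)‖ ≤ ‖b i‖ :=
    fun i z h => by simp [hz z h]
  have hc : ∀ i, ContinuousOn (fun z : ℂ => b i * z ^ d i * z ^ (-m)) (Metric.sphere 0 1) :=
    fun i => ContinuousOn.fun_mul (continuousOn_const.fun_mul (ContinuousOn.zpow₀
      (f := fun z => z) continuousOn_id _ fun z h => Or.inl (hz0 z h)))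
      (ContinuousOn.zpow₀ (f := fun z => z) continuousOn_id _ fun z h => Or.inl (hz0 z h))
  have key := hasSum_integral_of_dominated_convergence (μ := circ 1)
    (F := fun i z => b i * z ^ d i * z ^ (-m)) (f := fun z => (∑' i, b i * z ^ d i) * z ^ (-m))
    (fun i _ => ‖b i‖)
    (fun i => (integrable_circ zero_le_one (hc i)).aestronglyMeasurable)
    (fun i => (ae_circ zero_le_one).mono fun z h => hn i z h)
    (Filter.Eventually.of_forall fun _ => hb.norm) (integrable_const _)
    ((ae_circ zero_le_one).mono fun z h => HasSum.mul_right _ (Summable.hasSum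
      (Summable.of_norm (hb.norm.congr fun i => by simp [hz z h]))))
  refine key.congr_fun fun i => ?_
  have e : ∫ z, b i * z ^ d i * z ^ (-m) ∂circ 1 = b i * ∫ z, z ^ (d i - m) ∂circ 1 := by
    rw [← integral_const_mul]
    refine integral_congr_ae ((ae_circ zero_le_one).mono fun z h => ?_)
    simp only [mul_assoc, ← zpow_add₀ (hz0 z h), sub_eq_add_neg]
  rw [e]
  split_ifs with h
  · simp [h]
  · rw [integral_circ_zpow one_pos (sub_ne_zero.2 h), mul_zero]

/-- If two Laurent series agree on the unit circle, then so do their homogeneous parts. This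
allows to choose the terms of each degree freely from one of the two series. -/
theorem hasSum_of_laurent_eq {ι : Type*} [Countable ι] (d : ι → ℤ) {b b' : ι → ℂ} {S : ℂ}
    (hb : HasSum b S) (hb' : Summable b')
    (h : ∀ z : ℂ, ‖z‖ = 1 → ∑' i, b i * z ^ d i = ∑' i, b' i * z ^ d i) (p : ℤ → Prop)
    [DecidablePred p] : HasSum (fun i => if p (d i) then b i else b' i) S := by
  -- Both fibre sums are the `m`-th Fourier coefficient of the same function on the circle.
  have hfib : ∀ m, ∑' i : d ⁻¹' {m}, b i = ∑' i : d ⁻¹' {m}, b' i := fun m => by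
    rw [tsum_subtype, tsum_subtype]
    have e : ∀ b : ι → ℂ, (d ⁻¹' {m}).indicator b = fun i => if d i = m then b i else 0 :=
      fun b => by
        funext i
        by_cases h : d i = m
        · rw [if_pos h, Set.indicator_of_mem (by exact h)]
        · rw [if_neg h, Set.indicator_of_notMem (by exact h)]
    rw [e, e, (hasSum_integral_circ_zpow d hb.summable m).tsum_eq,
      (hasSum_integral_circ_zpow d hb' m).tsum_eq]
    refine integral_congr_ae ((ae_circ zero_le_one).mono fun z hz => ?_)
    exact congrArg (· * z ^ (-m)) (h z (mem_sphere_zero_iff_norm.1 hz))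
  have hs : Summable fun i => if p (d i) then b i else b' i := by
    refine Summable.of_norm_bounded (hb.summable.norm.add hb'.norm) fun i => ?_
    split_ifs
    · exact le_add_of_nonneg_right (norm_nonneg _)
    · exact le_add_of_nonneg_left (norm_nonneg _)
  have h1 := hs.hasSum.tsum_fiberwise d
  have h2 := hb.tsum_fiberwise d
  have e : ∀ m, ∑' i : d ⁻¹' {m}, (if p (d i) then b i else b' i) = ∑' i : d ⁻¹' {m}, b i :=
    fun m => by
      by_cases hp : p m
      · exact tsum_congr fun i => if_pos ((show d i = m from i.2).symm ▸ hp)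
      · rw [hfib]
        exact tsum_congr fun i => if_neg ((show d i = m from i.2).symm ▸ hp)
  simp only [e] at h1
  rw [h2.unique h1]
  exact hs.hasSum

/-! ### Holomorphic functions vanishing at real points -/

/-- Identity theorem: the real zeros accumulate at `0`. -/
theorem eq_zero_of_eq_zero_on_real_disc {ε : ℝ} (hε : 0 < ε) {f : ℂ → ℂ}
    (hf : DifferentiableOn ℂ f (Metric.ball 0 ε)) (h0 : ∀ t : ℝ, |t| < ε → f t = 0) {z : ℂ}
    (hz : ‖z‖ < ε) : f z = 0 := by
  have hfreq : ∃ᶠ w in nhdsWithin (0 : ℂ) {0}ᶜ, f w = 0 := by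
    have ht : Filter.Tendsto (fun t : ℝ => (t : ℂ)) (nhdsWithin 0 {0}ᶜ)
        (nhdsWithin (0 : ℂ) {0}ᶜ) := by
      refine tendsto_nhdsWithin_iff.2 ⟨?_, ?_⟩
      · simpa using (Complex.continuous_ofReal.tendsto 0).mono_left nhdsWithin_le_nhds
      · filter_upwards [self_mem_nhdsWithin] with t ht
        simpa using ht
    refine ht.frequently (Filter.Eventually.frequently ?_)
    filter_upwards [mem_nhdsWithin_of_mem_nhds (Metric.ball_mem_nhds (0 : ℝ) hε)] with t ht
    exact h0 t (by simpa using ht)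
  exact (hf.analyticOnNhd Metric.isOpen_ball).eqOn_zero_of_preconnected_of_frequently_eq_zero
    (convex_ball _ _).isPreconnected (Metric.mem_ball_self hε) hfreq (by simpa using hz)

/-- A holomorphic function on a polydisc that vanishes at all real points vanishes. -/
theorem eq_zero_of_eq_zero_on_real {ι : Type*} [Fintype ι] {ε : ℝ} (hε : 0 < ε)
    {f : (ι → ℂ) → ℂ} (hf : DifferentiableOn ℂ f (Metric.ball 0 ε))
    (h0 : ∀ t : ι → ℝ, (∀ k, |t k| < ε) → f (fun k => t k) = 0) {z : ι → ℂ}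
    (hz : ∀ k, ‖z k‖ < ε) : f z = 0 := by
  classical
  -- The coordinates are released from being real one at a time; `S` collects those that may be
  -- complex.
  have key : ∀ S : Finset ι, ∀ z : ι → ℂ, (∀ k, ‖z k‖ < ε) → (∀ k ∉ S, (z k).im = 0) →
      f z = 0 := by
    intro S
    induction S using Finset.induction_on with
    | empty =>
      intro z hz him
      have e : z = fun k => (((z k).re : ℝ) : ℂ) := funext fun k =>
        Complex.ext (by simp) (by simpa using him k)
      rw [e]
      exact h0 _ fun k => (Complex.abs_re_le_norm _).trans_lt (hz k)
    | insert a S ha ih =>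
      intro z hz him
      have hb : ∀ w : ℂ, ‖w‖ < ε → ∀ k, ‖Function.update z a w k‖ < ε := fun w hw k => by
        by_cases hk : k = a
        · subst hk; simpa using hw
        · simpa [hk] using hz k
      have := eq_zero_of_eq_zero_on_real_disc hε (f := fun w => f (Function.update z a w))
        (hf.comp (Differentiable.differentiableOn ?_) fun w hw => ?_) (fun t ht => ?_) (hz a)
      · simpa using this
      · rw [differentiable_pi]
        intro k
        by_cases hk : k = a
        · subst hk; simp
        · simp [hk]
      · rw [mem_ball_zero_iff] at hw ⊢
        exact (pi_norm_lt_iff hε).2 (hb w hw)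
      · refine ih _ (hb t (by simpa using ht)) fun k hk => ?_
        by_cases hka : k = a
        · subst hka; simp
        · simpa [hka] using him k (by simp [hka, hk])
  exact key Finset.univ z hz (by simp)

/-- A holomorphic function near `0` that vanishes on the antidiagonal `v = conj u` vanishes. -/
theorem eq_zero_of_eq_zero_on_antidiagonal {n : ℕ} {ε : ℝ} (hε : 0 < ε)
    {F : (Fin n → ℂ) × (Fin n → ℂ) → ℂ} (hF : DifferentiableOn ℂ F (Metric.ball 0 ε))
    (h0 : ∀ u : Fin n → ℂ, (∀ k, ‖u k‖ < ε) → F (u, fun k => starRingEnd ℂ (u k)) = 0)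
    {p : (Fin n → ℂ) × (Fin n → ℂ)} (h1 : ∀ k, ‖p.1 k‖ < ε / 2) (h2 : ∀ k, ‖p.2 k‖ < ε / 2) :
    F p = 0 := by
  have hε2 : 0 < ε / 2 := half_pos hε
  -- The linear isomorphism `(a, b) ↦ (a + i b, a - i b)` takes real points to the antidiagonal.
  -- Both it and its inverse are controlled by the triangle inequality, whence `ε / 2`.
  set T : (Fin n ⊕ Fin n → ℂ) → (Fin n → ℂ) × (Fin n → ℂ) := fun w =>
    (fun k => w (Sum.inl k) + Complex.I * w (Sum.inr k),
      fun k => w (Sum.inl k) - Complex.I * w (Sum.inr k)) with hT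
  have hTd : Differentiable ℂ T := by
    rw [hT]
    fun_prop
  have hTb : ∀ w : Fin n ⊕ Fin n → ℂ, (∀ k, ‖w k‖ < ε / 2) →
      (∀ k, ‖(T w).1 k‖ < ε) ∧ ∀ k, ‖(T w).2 k‖ < ε := fun w hw => by
    have e : ∀ k, ‖w (Sum.inl k)‖ + ‖Complex.I * w (Sum.inr k)‖ < ε := fun k => by
      have h1 := hw (Sum.inl k)
      have h2 := hw (Sum.inr k)
      rw [norm_mul, Complex.norm_I, one_mul]
      linarith
    exact ⟨fun k => (norm_add_le _ _).trans_lt (e k), fun k => (norm_sub_le _ _).trans_lt (e k)⟩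
  have key := eq_zero_of_eq_zero_on_real hε2 (f := fun w => F (T w))
    (hF.comp hTd.differentiableOn fun w hw => ?_) (fun t ht => ?_)
    (z := Sum.elim (fun k => (p.1 k + p.2 k) / 2) fun k => (p.1 k - p.2 k) / (2 * Complex.I))
    fun k => ?_
  · convert! key using 2
    rw [hT]
    refine Prod.ext (funext fun k => ?_) (funext fun k => ?_)
    · simp only [Sum.elim_inl, Sum.elim_inr]
      field_simp
      ring
    · simp only [Sum.elim_inl, Sum.elim_inr]
      field_simp
      ring
  · rw [mem_ball_zero_iff, pi_norm_lt_iff hε2] at hw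
    rw [mem_ball_zero_iff, Prod.norm_def, max_lt_iff, pi_norm_lt_iff hε, pi_norm_lt_iff hε]
    exact hTb w hw
  · have e : T (fun k => ((t k : ℝ) : ℂ)) = ((T fun k => ((t k : ℝ) : ℂ)).1,
        fun k => starRingEnd ℂ ((T fun k => ((t k : ℝ) : ℂ)).1 k)) := by
      refine Prod.ext rfl (funext fun k => ?_)
      simp [hT, sub_eq_add_neg]
    rw [e]
    exact h0 _ (hTb (fun k => ((t k : ℝ) : ℂ)) fun k => by simpa using ht k).1
  · rcases k with k | k
    · simp only [Sum.elim_inl, norm_div, Complex.norm_ofNat]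
      have := norm_add_le (p.1 k) (p.2 k)
      linarith [h1 k, h2 k]
    · simp only [Sum.elim_inr, norm_div, norm_mul, Complex.norm_ofNat, Complex.norm_I, mul_one]
      have := norm_sub_le (p.1 k) (p.2 k)
      linarith [h1 k, h2 k]

section

variable {n s : ℕ}

/-! ### Points of the extension of `M_red` -/

theorem mkExt_eq_of_scale {ξ η ξ' η' : Fin (n + 1) → ℂ} {h : momentMapExt n s ξ η = 1}
    {h' : momentMapExt n s ξ' η' = 1} {a : ℂ} (ha : a ≠ 0) (hξ : ∀ k, ξ k = a * ξ' k)
    (hη : ∀ k, η' k = a * η k) : mkExt n s ξ η h = mkExt n s ξ' η' h' := by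
  refine Quotient.sound ⟨Units.mk0 a ha, Subtype.ext (Prod.ext (funext fun k => ?_)
    (funext fun k => ?_))⟩
  · exact (hξ k).symm
  · change (((Units.mk0 a ha)⁻¹ : ℂˣ) : ℂ) * η' k = η k
    rw [Units.val_inv_eq_inv_val, Units.val_mk0, hη k]
    field_simp

theorem mkExt_congr {ξ η ξ' η' : Fin (n + 1) → ℂ} {h : momentMapExt n s ξ η = 1}
    {h' : momentMapExt n s ξ' η' = 1} (hξ : ∀ k, ξ k = ξ' k) (hη : ∀ k, η k = η' k) :
    mkExt n s ξ η h = mkExt n s ξ' η' h' :=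
  mkExt_eq_of_scale one_ne_zero (by simpa using hξ) (by simpa [eq_comm] using hη)

theorem exists_eq_mkExt (x : MredExt n s) : ∃ ξ η h, x = mkExt n s ξ η h := by
  induction x using Quotient.inductionOn with
  | h p => exact ⟨p.1.1, p.1.2, p.2, rfl⟩

theorem exists_ne_zero_of_momentMapExt {ξ η : Fin (n + 1) → ℂ} (h : momentMapExt n s ξ η = 1) :
    (∃ i, ξ i ≠ 0) ∧ ∃ j, η j ≠ 0 := by
  constructor <;> by_contra! h0 <;> simp [momentMapExt, h0] at h

theorem continuous_mkExt {E : Type*} [TopologicalSpace E] {ξ η : E → Fin (n + 1) → ℂ}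
    (hξ : Continuous ξ) (hη : Continuous η) (h : ∀ z, momentMapExt n s (ξ z) (η z) = 1) :
    Continuous fun z => mkExt n s (ξ z) (η z) (h z) :=
  continuous_quotient_mk'.comp ((hξ.prodMk hη).subtype_mk h)

theorem differentiable_momentMapExt_homog (i j : Fin (n + 1)) :
    Differentiable ℂ fun p : (Fin n → ℂ) × (Fin n → ℂ) =>
      momentMapExt n s (homog i p.1) (homog j p.2) := by
  unfold momentMapExt
  exact Differentiable.fun_sum fun k _ =>
    ((differentiable_homog_fst i k).const_mul _).mul (differentiable_homog_snd j k)

theorem isOpen_coordRange (i j : Fin (n + 1)) : IsOpen (coordRange n s i j) :=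
  isOpen_ne_fun (differentiable_momentMapExt_homog i j).continuous continuous_const

/-- Holomorphic functions are holomorphic along holomorphic families of points. -/
theorem differentiable_comp_mkExt (g : Holo n s) {E : Type*} [NormedAddCommGroup E]
    [NormedSpace ℂ E] {ξ η : E → Fin (n + 1) → ℂ} (hξ : Differentiable ℂ ξ)
    (hη : Differentiable ℂ η) (h : ∀ z, momentMapExt n s (ξ z) (η z) = 1) :
    Differentiable ℂ fun z => g.1 (mkExt n s (ξ z) (η z) (h z)) := by
  intro z
  obtain ⟨⟨i, hi⟩, j, hj⟩ := exists_ne_zero_of_momentMapExt (h z)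
  have hξk : ∀ k, Differentiable ℂ fun z => ξ z k := fun k => (differentiable_pi.1 hξ) k
  have hηk : ∀ k, Differentiable ℂ fun z => η z k := fun k => (differentiable_pi.1 hη) k
  -- Near `z` the family stays in the chart domain of `(i, j)`, and `ψ` is its expression in that
  -- chart.
  set ψ : E → (Fin n → ℂ) × (Fin n → ℂ) := fun z =>
    (fun k => ξ z (i.succAbove k) / ξ z i, fun k => η z (j.succAbove k) / η z j) with hψ
  have h1 : ∀ k, DifferentiableAt ℂ (fun z => ξ z (i.succAbove k) / ξ z i) z := fun k => by
    simp only [div_eq_mul_inv]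
    exact (hξk (i.succAbove k) z).fun_mul ((hξk i z).fun_inv hi)
  have h2 : ∀ k, DifferentiableAt ℂ (fun z => η z (j.succAbove k) / η z j) z := fun k => by
    simp only [div_eq_mul_inv]
    exact (hηk (j.succAbove k) z).fun_mul ((hηk j z).fun_inv hj)
  have hψd : DifferentiableAt ℂ ψ z :=
    (differentiableAt_pi.2 h1).prodMk (differentiableAt_pi.2 h2)
  have hloc : ∀ w, ξ w i ≠ 0 → η w j ≠ 0 → ψ w ∈ coordRange n s i j ∧
      g.1 (mkExt n s (ξ w) (η w) (h w)) = coordExpr n s i j g.1 (ψ w) := fun w hi hj => by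
    obtain ⟨hp, he⟩ := coordPoint_projCoord n s i j (ξ w) (η w) (h w) hi hj
    refine ⟨hp, ?_⟩
    rw [coordExpr, dif_pos (show ψ w ∈ coordRange n s i j from hp)]
    exact congrArg g.1 he.symm
  have hd : DifferentiableAt ℂ (fun w => coordExpr n s i j g.1 (ψ w)) z :=
    ((g.2 i j).differentiableAt ((isOpen_coordRange i j).mem_nhds (hloc z hi hj).1)).comp z hψd
  refine hd.congr_of_eventuallyEq ?_
  filter_upwards [(hξk i).continuous.continuousAt.eventually_ne hi,
    (hηk j).continuous.continuousAt.eventually_ne hj] with w h1 h2 using (hloc w h1 h2).2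

/-! ### Two affine parametrizations -/

/-- The signs `ν_1, …, ν_n`. -/
def signs (n s : ℕ) : Fin n → ℂ := fun k => nu n s k.succ

theorem nu_zero (hs : 1 ≤ s) : nu n s 0 = 1 := if_pos hs

theorem norm_nu (k : Fin (n + 1)) : ‖nu n s k‖ = 1 := by
  unfold nu
  split_ifs <;> simp

theorem momentMapExt_eq (hs : 1 ≤ s) (ξ η : Fin (n + 1) → ℂ) :
    momentMapExt n s ξ η = ξ 0 * η 0 + ∑ k, signs n s k * ξ k.succ * η k.succ := by
  simp [momentMapExt, Fin.sum_univ_succ, nu_zero hs, signs]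

theorem momentMapExt_homog (hs : 1 ≤ s) (p : (Fin n → ℂ) × (Fin n → ℂ)) :
    momentMapExt n s (homog 0 p.1) (homog 0 p.2) = quadric (signs n s) p := by
  simp [momentMapExt_eq hs, homog, quadric]

/-- The polynomial `1 - ∑ ν_k x_k y_k`. -/
abbrev coquadric (n s : ℕ) : (Fin n → ℂ) × (Fin n → ℂ) → ℂ := quadric (-signs n s)

theorem coquadric_eq (p : (Fin n → ℂ) × (Fin n → ℂ)) :
    coquadric n s p = 1 - ∑ k, signs n s k * p.1 k * p.2 k := by
  simp [quadric, sub_eq_add_neg]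

theorem coquadric_smul {a b : ℂ} (hab : a * b = 1) (x y : Fin n → ℂ) :
    coquadric n s (a • x, b • y) = coquadric n s (x, y) := by
  rw [coquadric_eq, coquadric_eq]
  congr 1
  refine Finset.sum_congr rfl fun k _ => ?_
  simp only [Pi.smul_apply, smul_eq_mul]
  linear_combination (signs n s k * x k * y k) * hab

theorem momentMapExt_cons_left (hs : 1 ≤ s) (p : (Fin n → ℂ) × (Fin n → ℂ)) :
    momentMapExt n s (Fin.cons (coquadric n s p) p.1) (Fin.cons 1 p.2) = 1 := by
  simp [momentMapExt_eq hs, coquadric_eq]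

theorem momentMapExt_cons_right (hs : 1 ≤ s) (p : (Fin n → ℂ) × (Fin n → ℂ)) :
    momentMapExt n s (Fin.cons 1 p.1) (Fin.cons (coquadric n s p) p.2) = 1 := by
  simp [momentMapExt_eq hs, coquadric_eq]

/-- The point with `η^0 = 1`, and the other coordinates of `ξ`, `η` given by `x`, `y`. -/
def paramL (hs : 1 ≤ s) (p : (Fin n → ℂ) × (Fin n → ℂ)) : MredExt n s :=
  mkExt n s (Fin.cons (coquadric n s p) p.1) (Fin.cons 1 p.2) (momentMapExt_cons_left hs p)

/-- The point with `ξ^0 = 1`, and the other coordinates of `ξ`, `η` given by `x`, `y`. -/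
def paramR (hs : 1 ≤ s) (p : (Fin n → ℂ) × (Fin n → ℂ)) : MredExt n s :=
  mkExt n s (Fin.cons 1 p.1) (Fin.cons (coquadric n s p) p.2) (momentMapExt_cons_right hs p)

theorem differentiable_cons {E : Type*} [NormedAddCommGroup E] [NormedSpace ℂ E] {f : E → ℂ}
    {F : E → Fin n → ℂ} (hf : Differentiable ℂ f) (hF : Differentiable ℂ F) :
    Differentiable ℂ fun z => (Fin.cons (f z) (F z) : Fin (n + 1) → ℂ) := by
  rw [differentiable_pi]
  intro k
  refine Fin.cases ?_ (fun l => ?_) k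
  · simpa using hf
  · simpa using (differentiable_pi.1 hF) l

theorem continuous_paramL (hs : 1 ≤ s) : Continuous (paramL (n := n) hs) :=
  continuous_mkExt (differentiable_cons (differentiable_quadric _) differentiable_fst).continuous
    (differentiable_cons (differentiable_const 1) differentiable_snd).continuous _

theorem continuous_paramR (hs : 1 ≤ s) : Continuous (paramR (n := n) hs) :=
  continuous_mkExt (differentiable_cons (differentiable_const 1) differentiable_fst).continuous
    (differentiable_cons (differentiable_quadric _) differentiable_snd).continuous _

theorem differentiable_comp_paramL (hs : 1 ≤ s) (g : Holo n s) :
    Differentiable ℂ fun p => g.1 (paramL hs p) :=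
  differentiable_comp_mkExt g
    (differentiable_cons (differentiable_quadric _) differentiable_fst)
    (differentiable_cons (differentiable_const 1) differentiable_snd) _

theorem differentiable_comp_paramR (hs : 1 ≤ s) (g : Holo n s) :
    Differentiable ℂ fun p => g.1 (paramR hs p) :=
  differentiable_comp_mkExt g
    (differentiable_cons (differentiable_const 1) differentiable_fst)
    (differentiable_cons (differentiable_quadric _) differentiable_snd) _

/-- In `paramL` one has `ξ^0 = c`; rescaling by `c⁻¹` normalizes `ξ^0` to `1` and makes `η^0 = c`.
-/
theorem paramL_eq_paramR (hs : 1 ≤ s) {x y : Fin n → ℂ} (hc : coquadric n s (x, y) ≠ 0) :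
    paramL hs (x, y)
      = paramR hs ((coquadric n s (x, y))⁻¹ • x, coquadric n s (x, y) • y) := by
  refine mkExt_eq_of_scale hc (fun k => ?_) fun k => ?_
  · refine Fin.cases ?_ (fun l => ?_) k
    · simp
    · simp [hc]
  · refine Fin.cases ?_ (fun l => ?_) k
    · simp only [Fin.cons_zero, mul_one]
      exact coquadric_smul (inv_mul_cancel₀ hc) x y
    · simp

/-- Scaling `η^0` to `1` shows that `paramL` reaches every point with `η^0 ≠ 0`. The value of the
quadric tells when `paramR` reaches it as well. -/
theorem mkExt_eq_paramL (hs : 1 ≤ s) {ξ η : Fin (n + 1) → ℂ} (h : momentMapExt n s ξ η = 1)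
    (h0 : η 0 ≠ 0) :
    coquadric n s (fun k => η 0 * ξ k.succ, fun k => (η 0)⁻¹ * η k.succ) = ξ 0 * η 0 ∧
    mkExt n s ξ η h = paramL hs (fun k => η 0 * ξ k.succ, fun k => (η 0)⁻¹ * η k.succ) := by
  have hq : coquadric n s (fun k => η 0 * ξ k.succ, fun k => (η 0)⁻¹ * η k.succ) = ξ 0 * η 0 := by
    refine (coquadric_smul (mul_inv_cancel₀ h0) (fun k => ξ k.succ) fun k => η k.succ).trans ?_
    rw [coquadric_eq]
    rw [momentMapExt_eq hs] at h
    linear_combination -h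
  refine ⟨hq, mkExt_eq_of_scale (inv_ne_zero h0) (fun k => ?_) fun k => ?_⟩
  · refine Fin.cases ?_ (fun l => ?_) k
    · simp only [Fin.cons_zero, hq]
      field_simp
    · simp only [Fin.cons_succ]
      field_simp
  · refine Fin.cases ?_ (fun l => ?_) k
    · simp [h0]
    · simp

/-- With `c = 1 + S` this is `1 - S / c = 1 / c`. It identifies the zeroth coordinate in the chart
`(u, v)` with the one in `paramL`. -/
theorem quadric_sub_self_smul {κ : Fin n → ℂ} {p : (Fin n → ℂ) × (Fin n → ℂ)}
    (hp : quadric κ p ≠ 0) : quadric (-κ) ((quadric κ p)⁻¹ • p.1, p.2) = (quadric κ p)⁻¹ := by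
  have e : ∑ k, κ k * p.1 k * p.2 k = quadric κ p - 1 := by simp [quadric]
  have e' : quadric (-κ) ((quadric κ p)⁻¹ • p.1, p.2)
      = 1 - (quadric κ p)⁻¹ * ∑ k, κ k * p.1 k * p.2 k := by
    rw [Finset.mul_sum, sub_eq_add_neg, ← Finset.sum_neg_distrib]
    refine congrArg₂ _ rfl (Finset.sum_congr rfl fun k _ => ?_)
    simp only [Pi.neg_apply, Pi.smul_apply, smul_eq_mul]
    ring
  rw [e', e]
  field_simp
  ring

/-- The coordinate expression of a function in the coordinates `u`, `v`. -/
theorem coordExpr_zero_eq_paramL (hs : 1 ≤ s) (g : MredExt n s → ℂ)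
    {p : (Fin n → ℂ) × (Fin n → ℂ)} (hp : quadric (signs n s) p ≠ 0) :
    coordExpr n s 0 0 g p = g (paramL hs ((quadric (signs n s) p)⁻¹ • p.1, p.2)) := by
  have hm := momentMapExt_homog hs p
  rw [coordExpr, dif_pos (show p ∈ coordRange n s 0 0 from hm.trans_ne hp)]
  congr 1
  refine mkExt_congr (fun k => ?_) fun k => ?_
  · rw [hm]
    refine Fin.cases ?_ (fun l => ?_) k
    · simp only [Fin.cons_zero, homog, Fin.insertNth_zero', one_div]
      exact (quadric_sub_self_smul hp).symm
    · simp [homog, div_eq_inv_mul]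
  · refine Fin.cases ?_ (fun l => ?_) k <;> simp [homog]

/-! ### The coefficients -/

theorem laurentCoeff_add {R : ℝ} (hR : 0 < R) {F G : (Fin n → ℂ) × (Fin n → ℂ) → ℂ}
    (hF : ContinuousOn F (torusSet2 n R)) (hG : ContinuousOn G (torusSet2 n R))
    (A B : Fin n → ℤ) :
    laurentCoeff R (fun p => F p + G p) A B = laurentCoeff R F A B + laurentCoeff R G A B := by
  unfold laurentCoeff
  rw [← integral_add (integrable_torus2 hR.le (hF.fun_mul (continuousOn_zmon_mul_zmon hR _ _)))
    (integrable_torus2 hR.le (hG.fun_mul (continuousOn_zmon_mul_zmon hR _ _)))]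
  refine integral_congr_ae (Filter.Eventually.of_forall fun p => ?_)
  ring

theorem laurentCoeff_const_mul {R : ℝ} (a : ℂ) (F : (Fin n → ℂ) × (Fin n → ℂ) → ℂ)
    (A B : Fin n → ℤ) : laurentCoeff R (fun p => a * F p) A B = a * laurentCoeff R F A B := by
  unfold laurentCoeff
  rw [← integral_const_mul]
  refine integral_congr_ae (Filter.Eventually.of_forall fun p => ?_)
  ring

/-- The coefficient of a holomorphic function at the fundamental monomial with index `(P, Q)`. -/
def holoCoeff (hs : 1 ≤ s) (i : Idx n) : Holo n s →ₗ[ℂ] ℂ where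
  toFun g := if deg i.2 ≤ deg i.1
    then laurentCoeff 1 (fun p => g.1 (paramL hs p)) (intIdx i.1) (intIdx i.2)
    else laurentCoeff 1 (fun p => g.1 (paramR hs p)) (intIdx i.1) (intIdx i.2)
  map_add' f g := by
    split_ifs
    · exact laurentCoeff_add one_pos (differentiable_comp_paramL hs f).continuous.continuousOn
        (differentiable_comp_paramL hs g).continuous.continuousOn _ _
    · exact laurentCoeff_add one_pos (differentiable_comp_paramR hs f).continuous.continuousOn
        (differentiable_comp_paramR hs g).continuous.continuousOn _ _
  map_smul' a g := by
    split_ifs <;> exact laurentCoeff_const_mul _ _ _ _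

theorem holoCoeff_apply (hs : 1 ≤ s) (i : Idx n) (g : Holo n s) : holoCoeff hs i g =
    if deg i.2 ≤ deg i.1
    then laurentCoeff 1 (fun p => g.1 (paramL hs p)) (intIdx i.1) (intIdx i.2)
    else laurentCoeff 1 (fun p => g.1 (paramR hs p)) (intIdx i.1) (intIdx i.2) := rfl

/-- The factor `1 / c` may be moved from `u` to `v`, which makes the chart symmetric in the two
parametrizations. -/
theorem coquadric_quadric_smul_left {p : (Fin n → ℂ) × (Fin n → ℂ)}
    (hp : quadric (signs n s) p ≠ 0) (hs : 1 ≤ s) :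
    paramL hs ((quadric (signs n s) p)⁻¹ • p.1, p.2)
      = paramR hs (p.1, (quadric (signs n s) p)⁻¹ • p.2) := by
  have h := quadric_sub_self_smul hp
  rw [paramL_eq_paramR hs (h.trans_ne (inv_ne_zero hp))]
  simp only [coquadric]
  rw [h, smul_smul, inv_inv, mul_inv_cancel₀ hp, one_smul]

/-- The integral formula for the coefficients. -/
theorem laurentCoeff_coordExpr (hs : 1 ≤ s) (g : Holo n s) {R : ℝ} (hR : 0 < R)
    (hR1 : (∑ k, ‖signs n s k‖) * R ^ 2 < 1) (i : Idx n) :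
    laurentCoeff R (fun p => coordExpr n s 0 0 g.1 p *
      quadric (signs n s) p ^ (((max (deg i.1) (deg i.2) : ℕ) : ℤ) - 1)) (intIdx i.1) (intIdx i.2)
      = holoCoeff hs i g := by
  have hρ : 0 < R / (1 - (∑ k, ‖signs n s k‖) * R ^ 2) + 1 := by
    have : 0 < R / (1 - (∑ k, ‖signs n s k‖) * R ^ 2) := div_pos hR (by linarith)
    linarith
  rw [holoCoeff_apply]
  split_ifs with hle
  · rw [max_eq_left hle, laurentCoeff_radius one_pos hρ (differentiable_comp_paramL hs g) i,
      ← laurentCoeff_comp_quadric hR hR1 (differentiable_comp_paramL hs g) (lt_add_one _) i]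
    refine laurentCoeff_congr hR.le (fun p hp => ?_) _ _
    rw [coordExpr_zero_eq_paramL hs _ (quadric_ne_zero_of_mem hR1 hp)]
  -- For `|P| < |Q|` the point is `paramR (u, v / c)`; exchanging `u` and `v` reduces to the
  -- substitution formula with `|Q|` as the relevant degree.
  · have hd : Differentiable ℂ fun p : (Fin n → ℂ) × (Fin n → ℂ) => g.1 (paramR hs p.swap) :=
      (differentiable_comp_paramR hs g).comp (differentiable_snd.prodMk differentiable_fst)
    have hsw : laurentCoeff 1 (fun p => g.1 (paramR hs p)) (intIdx i.1) (intIdx i.2)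
        = laurentCoeff 1 (fun p => g.1 (paramR hs p.swap)) (intIdx i.2) (intIdx i.1) :=
      (laurentCoeff_swap _ _ _).symm
    rw [max_eq_right (le_of_not_ge hle), hsw,
      laurentCoeff_radius one_pos hρ hd (i.2, i.1),
      ← laurentCoeff_comp_quadric hR hR1 hd (lt_add_one _) (i.2, i.1), ← laurentCoeff_swap]
    refine laurentCoeff_congr hR.le (fun p hp => ?_) _ _
    have hq : quadric (signs n s) p.swap = quadric (signs n s) p := by
      simp only [quadric, Prod.fst_swap, Prod.snd_swap, mul_right_comm]
    have hp0 := quadric_ne_zero_of_mem hR1 hp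
    rw [coordExpr_zero_eq_paramL hs _ (hq.trans_ne hp0),
      coquadric_quadric_smul_left (hq.trans_ne hp0), hq]
    rfl

/-! ### Fundamental monomials -/

/-- The holomorphic extension of a fundamental monomial. -/
def fundHolo (n s : ℕ) (i : Idx n) : Holo n s :=
  ⟨⟨monomExt n s (Fin.cons (deg i.2 - deg i.1) i.1) (Fin.cons (deg i.1 - deg i.2) i.2)
    (fund_deg i.1 i.2), continuous_monomExt n s _ _ _⟩,
    isHolomorphic_monomExt n s _ _ (fund_deg i.1 i.2)⟩

theorem restrict_fundHolo (i : Idx n) : restrict n s (fundHolo n s i) = fundMonom n s i := by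
  refine Subtype.ext (funext fun x => ?_)
  induction x using Quotient.inductionOn with
  | h ρ => rfl

theorem fundHolo_mkExt (i : Idx n) {ξ η : Fin (n + 1) → ℂ} (h : momentMapExt n s ξ η = 1) :
    (fundHolo n s i).1 (mkExt n s ξ η h) =
      ξ 0 ^ (deg i.2 - deg i.1) * η 0 ^ (deg i.1 - deg i.2) *
        (zmon (intIdx i.1) (fun k => ξ k.succ) * zmon (intIdx i.2) fun k => η k.succ) := by
  have e : (fundHolo n s i).1 (mkExt n s ξ η h) =
    (∏ k, ξ k ^ (Fin.cons (deg i.2 - deg i.1) i.1 : Fin (n + 1) → ℕ) k) *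
      ∏ k, η k ^ (Fin.cons (deg i.1 - deg i.2) i.2 : Fin (n + 1) → ℕ) k := rfl
  rw [e]
  simp only [Fin.prod_univ_succ, Fin.cons_zero, Fin.cons_succ, zmon_intIdx]
  ring

/-- By truncated subtraction the power of the quadric disappears if `|P| ≥ |Q|`; in `paramR` it
disappears if `|P| ≤ |Q|`. -/
theorem fundHolo_paramL (hs : 1 ≤ s) (i : Idx n) (p : (Fin n → ℂ) × (Fin n → ℂ)) :
    (fundHolo n s i).1 (paramL hs p) = coquadric n s p ^ (deg i.2 - deg i.1) *
      (zmon (intIdx i.1) p.1 * zmon (intIdx i.2) p.2) := by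
  rw [paramL, fundHolo_mkExt]
  simp

theorem fundHolo_paramR (hs : 1 ≤ s) (i : Idx n) (p : (Fin n → ℂ) × (Fin n → ℂ)) :
    (fundHolo n s i).1 (paramR hs p) = coquadric n s p ^ (deg i.1 - deg i.2) *
      (zmon (intIdx i.1) p.1 * zmon (intIdx i.2) p.2) := by
  rw [paramR, fundHolo_mkExt]
  simp

/-- Powers of the quadric contain only monomials `u^E v^E`, so they preserve the difference of the
degrees in `u` and `v`. Thus a nontrivial power does no harm when the differences of `i` and `j` are
distinct. -/
theorem laurentCoeff_pow_mul_zmon {R : ℝ} (hR : 0 < R) (κ : Fin n → ℂ) (N : ℕ) (i j : Idx n)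
    (h : N = 0 ∨ (deg i.1 : ℤ) - deg i.2 ≠ deg j.1 - deg j.2) (hij : i = j → N = 0) :
    laurentCoeff R (fun p => quadric κ p ^ N * (zmon (intIdx i.1) p.1 * zmon (intIdx i.2) p.2))
      (intIdx j.1) (intIdx j.2) = if i = j then 1 else 0 := by
  rw [laurentCoeff_zmon_mul hR]
  split_ifs with he
  · simp only [hij he, pow_zero, he, sub_self]
    rw [laurentCoeff_one hR, if_pos ⟨rfl, rfl⟩]
  · rcases h with rfl | h
    · simp only [pow_zero]
      rw [laurentCoeff_one hR, if_neg]
      rw [sub_eq_zero, sub_eq_zero, intIdx_injective.eq_iff, intIdx_injective.eq_iff]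
      exact fun h => he (Prod.ext h.1.symm h.2.symm)
    · refine laurentCoeff_quadric_pow_eq_zero hR κ N fun E _ h1 h2 => h ?_
      have e := congrArg (fun A : Fin n → ℤ => ∑ k, A k) (h1.trans h2.symm)
      simp only [Pi.sub_apply, Finset.sum_sub_distrib, sum_intIdx] at e
      omega

/-- If `i` and `j` lie on the same side of the case distinction, the power of the quadric is
trivial; otherwise their degree differences have different signs or just one of them is zero. -/
theorem holoCoeff_fundHolo (hs : 1 ≤ s) (i j : Idx n) :
    holoCoeff hs j (fundHolo n s i) = if i = j then 1 else 0 := by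
  rw [holoCoeff_apply]
  simp only [fundHolo_paramL, fundHolo_paramR]
  split_ifs with h1 h2 h2
  · rw [laurentCoeff_pow_mul_zmon one_pos, if_pos h2] <;> [skip; intro _] <;> subst h2 <;> omega
  · rw [laurentCoeff_pow_mul_zmon one_pos _ _ _ _ (by omega) fun h => absurd h h2, if_neg h2]
  · rw [laurentCoeff_pow_mul_zmon one_pos, if_pos h2] <;> [skip; intro _] <;> subst h2 <;> omega
  · rw [laurentCoeff_pow_mul_zmon one_pos _ _ _ _ (by omega) fun h => absurd h h2, if_neg h2]

/-! ### A bound for the fundamental monomials -/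

/-- The function `[(ξ, η)] ↦ ‖ξ‖ ‖η‖`. -/
def extNorm (n s : ℕ) : MredExt n s → ℝ :=
  Quotient.lift (fun p : LevelSetExt n s => ‖p.1.1‖ * ‖p.1.2‖) (by
    rintro p q ⟨a, rfl⟩
    change ‖(a : ℂ) • q.1.1‖ * ‖((a⁻¹ : ℂˣ) : ℂ) • q.1.2‖ = ‖q.1.1‖ * ‖q.1.2‖
    rw [norm_smul, norm_smul, Units.val_inv_eq_inv_val, norm_inv]
    have : ‖(a : ℂ)‖ ≠ 0 := norm_ne_zero_iff.2 a.ne_zero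
    field_simp)

theorem continuous_extNorm : Continuous (extNorm n s) := by
  refine Continuous.quotient_lift ?_ _
  have h1 : Continuous fun p : LevelSetExt n s => p.1 := continuous_subtype_val
  fun_prop

theorem norm_fundHolo_le (i : Idx n) {x : MredExt n s} {r : ℝ} (hr : 1 ≤ r)
    (hx : extNorm n s x ≤ r) : ‖(fundHolo n s i).1 x‖ ≤ r ^ (deg i.1 + deg i.2) := by
  obtain ⟨ξ, η, h, rfl⟩ := exists_eq_mkExt x
  have hx' : ‖ξ‖ * ‖η‖ ≤ r := hx
  -- After the factor `ξ^0` or `η^0` is included, the monomial has degree `m` in `ξ` and degree `m`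
  -- in `η`.
  set m := max (deg i.1) (deg i.2) with hm
  have h1 : ‖ξ 0 ^ (deg i.2 - deg i.1) * zmon (intIdx i.1) (fun k => ξ k.succ)‖ ≤ ‖ξ‖ ^ m := by
    have e : m = deg i.2 - deg i.1 + deg i.1 := by omega
    rw [norm_mul, norm_pow, e, pow_add]
    exact mul_le_mul (pow_le_pow_left₀ (norm_nonneg _) (norm_le_pi_norm ξ 0) _)
      (norm_zmon_intIdx_le (fun k => norm_le_pi_norm ξ k.succ) _) (norm_nonneg _) (by positivity)
  have h2 : ‖η 0 ^ (deg i.1 - deg i.2) * zmon (intIdx i.2) (fun k => η k.succ)‖ ≤ ‖η‖ ^ m := by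
    have e : m = deg i.1 - deg i.2 + deg i.2 := by omega
    rw [norm_mul, norm_pow, e, pow_add]
    exact mul_le_mul (pow_le_pow_left₀ (norm_nonneg _) (norm_le_pi_norm η 0) _)
      (norm_zmon_intIdx_le (fun k => norm_le_pi_norm η k.succ) _) (norm_nonneg _) (by positivity)
  rw [fundHolo_mkExt, mul_mul_mul_comm, norm_mul]
  calc _ ≤ ‖ξ‖ ^ m * ‖η‖ ^ m := mul_le_mul h1 h2 (norm_nonneg _) (by positivity)
    _ = (‖ξ‖ * ‖η‖) ^ m := (mul_pow _ _ _).symm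
    _ ≤ r ^ m := pow_le_pow_left₀ (by positivity) hx' _
    _ ≤ r ^ (deg i.1 + deg i.2) := pow_le_pow_right₀ hr (by omega)

/-! ### The expansion into fundamental monomials -/

theorem hasSum_entire {G : (Fin n → ℂ) × (Fin n → ℂ) → ℂ} (hG : Differentiable ℂ G)
    (x y : Fin n → ℂ) : HasSum (fun i : Idx n => laurentCoeff 1 G (intIdx i.1) (intIdx i.2) *
      (zmon (intIdx i.1) x * zmon (intIdx i.2) y)) (G (x, y)) := by
  have hρ : 0 < ‖x‖ + ‖y‖ + 1 := by positivity
  simp only [laurentCoeff_radius one_pos hρ hG]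
  refine hasSum_laurentCoeff hρ hG (fun k => ?_) fun k => ?_
  · have := norm_le_pi_norm x k
    linarith [norm_nonneg y]
  · have := norm_le_pi_norm y k
    linarith [norm_nonneg x]

/-- The gluing argument. Graded by `|P| - |Q|`, the terms of nonnegative degree come from `G_L (x,
y)`, those of negative degree from `G_R (x / c, c y)`. The factor `c^(|Q|-|P|)` of the latter is the
one in `f_{P,Q}`. -/
theorem hasSum_holoCoeff_paramL (hs : 1 ≤ s) (g : Holo n s) {x y : Fin n → ℂ}
    (hc : coquadric n s (x, y) ≠ 0) :
    HasSum (fun i => holoCoeff hs i g * (fundHolo n s i).1 (paramL hs (x, y)))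
      (g.1 (paramL hs (x, y))) := by
  set c := coquadric n s (x, y) with hcdef
  have hL := differentiable_comp_paramL hs g
  have hR := differentiable_comp_paramR hs g
  have hpow : ∀ (z : ℂ), z ≠ 0 → ∀ i : Idx n, z ^ deg i.1 * z⁻¹ ^ deg i.2
      = z ^ ((deg i.1 : ℤ) - deg i.2) := fun z hz i => by
    rw [zpow_sub₀ hz, zpow_natCast, zpow_natCast, inv_pow, div_eq_mul_inv]
  have key := hasSum_of_laurent_eq (fun i : Idx n => (deg i.1 : ℤ) - deg i.2)
    (hasSum_entire hL x y) (hasSum_entire hR (c⁻¹ • x) (c • y)).summable (fun z hz => ?_)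
    (fun m => 0 ≤ m)
  · refine key.congr_fun fun i => ?_
    rw [holoCoeff_apply, fundHolo_paramL, ← hcdef]
    by_cases h : deg i.2 ≤ deg i.1
    · rw [if_pos h, if_pos (by omega), Nat.sub_eq_zero_of_le h, pow_zero, one_mul]
    · rw [if_neg h, if_neg (by omega), zmon_intIdx_smul, zmon_intIdx_smul,
        pow_sub₀ _ hc (le_of_not_ge h), inv_pow]
      ring
  · have hz0 : z ≠ 0 := norm_ne_zero_iff.1 (by rw [hz]; exact one_ne_zero)
    have e : ∀ (a : Idx n → ℂ) (x y : Fin n → ℂ),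
        (fun i : Idx n => a i * (zmon (intIdx i.1) x * zmon (intIdx i.2) y) *
          z ^ ((deg i.1 : ℤ) - deg i.2)) =
        fun i : Idx n => a i * (zmon (intIdx i.1) (z • x) * zmon (intIdx i.2) (z⁻¹ • y)) :=
      fun a x y => funext fun i => by
        rw [zmon_intIdx_smul, zmon_intIdx_smul, ← hpow z hz0]
        ring
    rw [e, e, (hasSum_entire hL _ _).tsum_eq, (hasSum_entire hR _ _).tsum_eq]
    have hcz : coquadric n s (z • x, z⁻¹ • y) = c := coquadric_smul (mul_inv_cancel₀ hz0) x y
    rw [paramL_eq_paramR hs (hcz.trans_ne hc), hcz, smul_comm z, smul_comm z⁻¹]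

theorem continuous_tsum_fundHolo {a : Idx n → ℂ}
    (ha : ∀ r : ℝ, 1 ≤ r → Summable fun i : Idx n => ‖a i‖ * r ^ (deg i.1 + deg i.2)) :
    Continuous fun x => ∑' i, a i * (fundHolo n s i).1 x := by
  refine continuous_iff_continuousAt.2 fun x => ?_
  set r := max 1 (extNorm n s x + 1) with hr
  have hxr : extNorm n s x < r := lt_of_lt_of_le (lt_add_one _) (le_max_right _ _)
  have hx : {y | extNorm n s y < r} ∈ nhds x :=
    (isOpen_lt continuous_extNorm continuous_const).mem_nhds hxr
  refine ContinuousOn.continuousAt (s := {y | extNorm n s y < r}) ?_ hx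
  refine continuousOn_tsum (fun i => ((fundHolo n s i).1.continuous.const_mul _).continuousOn)
    (ha r (le_max_left _ _)) fun i y hy => ?_
  rw [norm_mul]
  exact mul_le_mul_of_nonneg_left (norm_fundHolo_le i (le_max_left _ _) (le_of_lt hy))
    (norm_nonneg _)

/-- Adding `t` to `ξ^0` and `η^0` changes the quadratic form from `1` to `1 + t (ξ^0 + η^0) + t²`;
dividing `ξ` by this returns to the level set. -/
theorem momentMapExt_perturb (hs : 1 ≤ s) {ξ η : Fin (n + 1) → ℂ} (h : momentMapExt n s ξ η = 1)
    {t : ℂ} (ht : 1 + t * (ξ 0 + η 0) + t ^ 2 ≠ 0) :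
    momentMapExt n s (fun k => (ξ k + t * if k = 0 then 1 else 0) /
      (1 + t * (ξ 0 + η 0) + t ^ 2)) (fun k => η k + t * if k = 0 then 1 else 0) = 1 := by
  rw [momentMapExt_eq hs] at h ⊢
  simp only [Fin.succ_ne_zero, if_true, if_false, mul_zero, add_zero, mul_one]
  have e : ∑ k : Fin n, signs n s k * (ξ k.succ / (1 + t * (ξ 0 + η 0) + t ^ 2)) * η k.succ
      = (1 - ξ 0 * η 0) / (1 + t * (ξ 0 + η 0) + t ^ 2) := by
    rw [← h, add_sub_cancel_left, Finset.sum_div]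
    refine Finset.sum_congr rfl fun k _ => ?_
    ring
  rw [e]
  field_simp
  ring

/-- Continuous functions on the extension of `M_red` are determined by their values at the points
with `ξ^0 ≠ 0` and `η^0 ≠ 0`. -/
theorem eq_of_eq_on_generic (hs : 1 ≤ s) {f g : MredExt n s → ℂ} (hf : Continuous f)
    (hg : Continuous g) (h : ∀ ξ η (h : momentMapExt n s ξ η = 1), ξ 0 ≠ 0 → η 0 ≠ 0 →
      f (mkExt n s ξ η h) = g (mkExt n s ξ η h)) (x : MredExt n s) : f x = g x := by
  obtain ⟨ξ, η, hξη, rfl⟩ := exists_eq_mkExt x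
  set m : ℂ → ℂ := fun t => 1 + t * (ξ 0 + η 0) + t ^ 2 with hm
  have hmc : Continuous m := by rw [hm]; fun_prop
  have hγ : Continuous fun t : {t : ℂ // m t ≠ 0} => mkExt n s
      (fun k => (ξ k + t.1 * if k = 0 then 1 else 0) / m t)
      (fun k => η k + t.1 * if k = 0 then 1 else 0) (momentMapExt_perturb hs hξη t.2) := by
    refine continuous_mkExt (continuous_pi fun k => ?_) (continuous_pi fun k => ?_) _
    · exact Continuous.div (by fun_prop) (hmc.comp continuous_subtype_val) fun t => t.2
    · fun_prop
  set γ : {t : ℂ // m t ≠ 0} → MredExt n s := fun t => mkExt n s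
      (fun k => (ξ k + t.1 * if k = 0 then 1 else 0) / m t)
      (fun k => η k + t.1 * if k = 0 then 1 else 0) (momentMapExt_perturb hs hξη t.2) with hγdef
  have h0 : m 0 ≠ 0 := by simp [hm]
  have hγ0 : γ ⟨0, h0⟩ = mkExt n s ξ η hξη := mkExt_congr (fun k => by simp [hm]) fun k => by simp
  have hev : ∀ᶠ t in nhdsWithin (0 : ℂ) {0}ᶜ, ξ 0 + t ≠ 0 ∧ η 0 + t ≠ 0 := by
    have aux : ∀ a : ℂ, ∀ᶠ t in nhdsWithin (0 : ℂ) {0}ᶜ, a + t ≠ 0 := fun a => by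
      by_cases ha : a = 0
      · filter_upwards [self_mem_nhdsWithin] with t ht
        simpa [ha] using ht
      · have hc : Continuous fun t : ℂ => a + t := by fun_prop
        exact nhdsWithin_le_nhds (hc.continuousAt.eventually_ne (by simpa using ha))
    exact (aux _).and (aux _)
  have hclosed : IsClosed {t | f (γ t) = g (γ t)} :=
    isClosed_eq (hf.comp hγ) (hg.comp hγ)
  -- For all small `t ≠ 0` the perturbed point has both zeroth coordinates nonzero, so `t = 0` is a
  -- limit of parameters where the functions agree.
  have hmem : (⟨0, h0⟩ : {t : ℂ // m t ≠ 0}) ∈ closure {t | f (γ t) = g (γ t)} := by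
    have hopen : {t : ℂ | m t ≠ 0} ∈ nhds (0 : ℂ) :=
      (isOpen_ne_fun hmc continuous_const).mem_nhds h0
    rw [mem_closure_iff_nhds]
    intro V hV
    rw [nhds_subtype_eq_comap, Filter.mem_comap] at hV
    obtain ⟨W, hW, hWV⟩ := hV
    obtain ⟨t, ⟨ht1, ht2⟩, ht3, ht4⟩ := (hev.and (Filter.Eventually.filter_mono nhdsWithin_le_nhds
      ((Filter.eventually_mem_set.2 hopen).and (Filter.eventually_mem_set.2 hW)))).exists
    refine ⟨⟨t, ht3⟩, hWV ht4, h _ _ _ ?_ ?_⟩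
    · exact div_ne_zero (by simpa using ht1) ht3
    · simpa using ht2
  rw [hclosed.closure_eq] at hmem
  have : f (γ ⟨0, h0⟩) = g (γ ⟨0, h0⟩) := hmem
  rwa [hγ0] at this

/-! ### Estimates for the coefficients -/

theorem norm_holoCoeff_le (hs : 1 ≤ s) {g : Holo n s} {ρ M : ℝ} (hρ : 0 < ρ)
    (hM : ∀ x ∈ paramL hs '' torusSet2 n ρ ∪ paramR hs '' torusSet2 n ρ, ‖g.1 x‖ ≤ M)
    (i : Idx n) : ‖holoCoeff hs i g‖ ≤ M * ρ⁻¹ ^ (deg i.1 + deg i.2) := by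
  rw [holoCoeff_apply]
  split_ifs
  · rw [laurentCoeff_radius one_pos hρ (differentiable_comp_paramL hs g) i]
    exact norm_laurentCoeff_le hρ (fun p hp => hM _ (Or.inl (Set.mem_image_of_mem _ hp))) _ _
  · rw [laurentCoeff_radius one_pos hρ (differentiable_comp_paramR hs g) i]
    exact norm_laurentCoeff_le hρ (fun p hp => hM _ (Or.inr (Set.mem_image_of_mem _ hp))) _ _

theorem isCompact_param_torus (hs : 1 ≤ s) (ρ : ℝ) :
    IsCompact (paramL (n := n) hs '' torusSet2 n ρ ∪ paramR hs '' torusSet2 n ρ) :=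
  ((isCompact_torusSet2 n ρ).image (continuous_paramL hs)).union
    ((isCompact_torusSet2 n ρ).image (continuous_paramR hs))

/-- Cauchy's estimate at radius `2 r` gains the summable factor `(1 / 2)^(|P|+|Q|)`. -/
theorem norm_holoCoeff_mul_pow_le (hs : 1 ≤ s) {g : Holo n s} {r M : ℝ} (hr : 0 < r)
    (hM : ∀ x ∈ paramL hs '' torusSet2 n (2 * r) ∪ paramR hs '' torusSet2 n (2 * r), ‖g.1 x‖ ≤ M)
    (i : Idx n) :
    ‖holoCoeff hs i g‖ * r ^ (deg i.1 + deg i.2) ≤ M * (1 / 2) ^ (deg i.1 + deg i.2) := by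
  refine (mul_le_mul_of_nonneg_right (norm_holoCoeff_le hs (by positivity) hM i)
    (by positivity)).trans_eq ?_
  rw [mul_assoc, ← mul_pow]
  congr 2
  field_simp

theorem summable_norm_holoCoeff (hs : 1 ≤ s) (g : Holo n s) {r : ℝ} (hr : 1 ≤ r) :
    Summable fun i => ‖holoCoeff hs i g‖ * r ^ (deg i.1 + deg i.2) := by
  obtain ⟨M, hM⟩ := (isCompact_param_torus hs (2 * r)).exists_bound_of_continuousOn
    g.1.continuous.continuousOn
  exact Summable.of_nonneg_of_le (fun i => by positivity)
    (fun i => norm_holoCoeff_mul_pow_le hs (by linarith) hM i)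
    ((summable_geometric_idx n (by norm_num) (by norm_num)).mul_left M)

/-- The expansion of a holomorphic function into fundamental monomials. -/
theorem hasSum_holoCoeff (hs : 1 ≤ s) (g : Holo n s) (x : MredExt n s) :
    HasSum (fun i => holoCoeff hs i g * (fundHolo n s i).1 x) (g.1 x) := by
  have hsum : ∀ x, Summable fun i => holoCoeff hs i g * (fundHolo n s i).1 x := fun x =>
    Summable.of_norm_bounded (summable_norm_holoCoeff hs g (le_max_left 1 (extNorm n s x)))
      fun i => by
        rw [norm_mul]
        exact mul_le_mul_of_nonneg_left (norm_fundHolo_le i (le_max_left _ _) (le_max_right _ _))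
          (norm_nonneg _)
  have e := eq_of_eq_on_generic hs g.1.continuous
    (continuous_tsum_fundHolo (a := fun i => holoCoeff hs i g)
      fun r hr => summable_norm_holoCoeff hs g hr) (fun ξ η h h1 h2 => ?_) x
  · rw [e]
    exact (hsum x).hasSum
  · obtain ⟨hq, he⟩ := mkExt_eq_paramL hs h h2
    rw [he]
    exact (hasSum_holoCoeff_paramL hs g (hq.trans_ne (mul_ne_zero h1 h2))).tsum_eq.symm

/-! ### Injectivity of the restriction to the antidiagonal -/

theorem sum_norm_signs : ∑ k, ‖signs n s k‖ = n := by simp [signs, norm_nu]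

/-- Holomorphic functions are determined by their restriction to the antidiagonal. -/
theorem restrict_injective (hs : 1 ≤ s) : Function.Injective (restrict n s) := by
  suffices h : ∀ g : Holo n s, (∀ x, g.1 (antidiagonal n s x) = 0) → g = 0 by
    intro f g hfg
    refine sub_eq_zero.1 (h (f - g) fun x => ?_)
    exact sub_eq_zero.2 (congrFun (congrArg Subtype.val hfg) x)
  intro g hg0
  have hε : (0 : ℝ) < 1 / (n + 1) := by positivity
  -- Chosen so that `n ε² < 1`, which keeps the quadric away from `0` on the polydisc.
  set ε : ℝ := 1 / (n + 1) with hεdef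
  have hε1 : (∑ k, ‖signs n s k‖) * ε ^ 2 < 1 := by
    rw [sum_norm_signs, hεdef, div_pow, one_pow, mul_one_div, div_lt_one (by positivity)]
    nlinarith [(Nat.cast_nonneg n : (0 : ℝ) ≤ n)]
  have hne : ∀ p : (Fin n → ℂ) × (Fin n → ℂ), (∀ k, ‖p.1 k‖ ≤ ε) → (∀ k, ‖p.2 k‖ ≤ ε) →
      quadric (signs n s) p ≠ 0 := fun p h1 h2 => quadric_ne_zero hε1 h1 h2
  have hm := momentMapExt_homog (n := n) hs
  have hF : DifferentiableOn ℂ (coordExpr n s 0 0 g.1) (Metric.ball 0 ε) := by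
    refine (g.2 0 0).mono fun p hp => ?_
    rw [mem_ball_zero_iff, Prod.norm_def, max_lt_iff, pi_norm_lt_iff hε, pi_norm_lt_iff hε] at hp
    exact (hm p).trans_ne (hne p (fun k => (hp.1 k).le) fun k => (hp.2 k).le)
  have hanti : ∀ u : Fin n → ℂ, (∀ k, ‖u k‖ < ε) →
      coordExpr n s 0 0 g.1 (u, fun k => starRingEnd ℂ (u k)) = 0 := fun u hu => by
    set p : (Fin n → ℂ) × (Fin n → ℂ) := (u, fun k => starRingEnd ℂ (u k)) with hp
    have hp0 : quadric (signs n s) p ≠ 0 := hne p (fun k => (hu k).le) fun k => by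
      simpa [hp] using (hu k).le
    -- On the antidiagonal the quadric is real, and positive by the choice of `ε`. Dividing the
    -- homogeneous vector `(1, u)` by its square root gives a point of the real level set with these
    -- coordinates.
    obtain ⟨c, hc⟩ : ∃ c : ℝ, quadric (signs n s) p = c := by
      refine ⟨1 + ∑ k : Fin n, (if (k.succ : ℕ) < s then 1 else -1) * ‖u k‖ ^ 2, ?_⟩
      have : ∀ k, signs n s k * u k * starRingEnd ℂ (u k)
          = (((if (k.succ : ℕ) < s then 1 else -1) * ‖u k‖ ^ 2 : ℝ) : ℂ) := fun k => by
        rw [mul_assoc, Complex.mul_conj, Complex.normSq_eq_norm_sq, signs, nu]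
        split_ifs <;> simp
      simp only [quadric, hp, this]
      push_cast
      rfl
    have hcpos : 0 < c := by
      have h1 : ‖quadric (signs n s) p - 1‖ < 1 := by
        refine lt_of_le_of_lt ?_ hε1
        rw [quadric, add_sub_cancel_left, Finset.sum_mul]
        refine (norm_sum_le _ _).trans (Finset.sum_le_sum fun k _ => ?_)
        rw [norm_mul, norm_mul, mul_assoc, sq]
        refine mul_le_mul_of_nonneg_left (mul_le_mul (hu k).le ?_ (norm_nonneg _) hε.le)
          (norm_nonneg _)
        simpa [hp] using (hu k).le
      have h2 : |c - 1| < 1 := by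
        rw [hc, ← Complex.ofReal_one, ← Complex.ofReal_sub, Complex.norm_real] at h1
        exact h1
      linarith [(abs_lt.1 h2).1]
    have hsq : ((Real.sqrt c : ℝ) : ℂ)⁻¹ * ((Real.sqrt c : ℝ) : ℂ)⁻¹
        = (quadric (signs n s) p)⁻¹ := by
      rw [hc, ← mul_inv, ← Complex.ofReal_mul, Real.mul_self_sqrt hcpos.le]
    have hsq0 : ((Real.sqrt c : ℝ) : ℂ)⁻¹ ≠ 0 :=
      inv_ne_zero (Complex.ofReal_ne_zero.2 (Real.sqrt_pos.2 hcpos).ne')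
    have hconj : ∀ k, starRingEnd ℂ (((Real.sqrt c : ℝ) : ℂ)⁻¹ * homog 0 u k)
        = ((Real.sqrt c : ℝ) : ℂ)⁻¹ * homog 0 p.2 k := fun k => by
      rw [map_mul, map_inv₀, Complex.conj_ofReal]
      congr 1
      refine Fin.cases ?_ (fun l => ?_) k <;> simp [homog, hp]
    have hρ : momentMap n s (fun k => ((Real.sqrt c : ℝ) : ℂ)⁻¹ * homog 0 u k) = 1 := by
      have : momentMap n s (fun k => ((Real.sqrt c : ℝ) : ℂ)⁻¹ * homog 0 u k)
          = (quadric (signs n s) p)⁻¹ * momentMapExt n s (homog 0 p.1) (homog 0 p.2) := by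
        simp only [momentMap, momentMapExt, hconj, Finset.mul_sum]
        rw [← hsq]
        refine Finset.sum_congr rfl fun k _ => ?_
        ring
      rw [this, hm, inv_mul_cancel₀ hp0]
    rw [coordExpr, dif_pos (show p ∈ coordRange n s 0 0 from (hm p).trans_ne hp0)]
    refine Eq.trans (congrArg g.1 ?_) (hg0 (Quotient.mk _ ⟨_, hρ⟩))
    refine mkExt_eq_of_scale hsq0 (fun k => ?_) fun k => hconj k
    rw [hm, ← mul_assoc, hsq, div_eq_inv_mul]
  -- The chart expression vanishes on the polydisc of radius `ε / 2`, so the tori of radius `ε / 4`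
  -- give zero for every coefficient integral.
  have hε4 : 0 < ε / 4 := by positivity
  have hcoeff : ∀ i, holoCoeff hs i g = 0 := fun i => by
    rw [← laurentCoeff_coordExpr hs g hε4 (by
      refine lt_of_le_of_lt (mul_le_mul_of_nonneg_left ?_ (Finset.sum_nonneg
        fun k _ => norm_nonneg _)) hε1
      exact pow_le_pow_left₀ hε4.le (by linarith) 2) i]
    refine integral_eq_zero_of_ae ((ae_torus2 hε4.le).mono fun p hp => ?_)
    have := eq_zero_of_eq_zero_on_antidiagonal hε hF hanti (p := p)
      (fun k => by rw [mem_torusSet.1 hp.1 k]; linarith)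
      (fun k => by rw [mem_torusSet.1 hp.2 k]; linarith)
    simp [this]
  refine Subtype.ext (ContinuousMap.ext fun x => ?_)
  have := hasSum_holoCoeff hs g x
  simp only [hcoeff, zero_mul] at this
  exact this.unique hasSum_zero

/-! ### The topology -/

/-- The seminorm `∑ |a_{P,Q}(g)| r ^ (|P| + |Q|)` on holomorphic functions. -/
def holoSeminorm (hs : 1 ≤ s) (r : {r : ℝ // 1 ≤ r}) : Seminorm ℂ (Holo n s) :=
  Seminorm.of (fun g => ∑' i, ‖holoCoeff hs i g‖ * r.1 ^ (deg i.1 + deg i.2))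
    (fun f g => by
      have hr : 0 ≤ r.1 := zero_le_one.trans r.2
      rw [← (summable_norm_holoCoeff hs f r.2).tsum_add (summable_norm_holoCoeff hs g r.2)]
      refine (summable_norm_holoCoeff hs _ r.2).tsum_le_tsum (fun i => ?_)
        ((summable_norm_holoCoeff hs f r.2).add (summable_norm_holoCoeff hs g r.2))
      rw [← add_mul, map_add]
      exact mul_le_mul_of_nonneg_right (norm_add_le _ _) (by positivity))
    (fun a g => by
      rw [← tsum_mul_left]
      refine tsum_congr fun i => ?_
      rw [map_smul, norm_smul, mul_assoc])

theorem holoSeminorm_apply (hs : 1 ≤ s) (r : {r : ℝ // 1 ≤ r}) (g : Holo n s) :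
    holoSeminorm hs r g = ∑' i, ‖holoCoeff hs i g‖ * r.1 ^ (deg i.1 + deg i.2) := rfl

theorem norm_le_holoSeminorm (hs : 1 ≤ s) (r : {r : ℝ // 1 ≤ r}) (g : Holo n s) {x : MredExt n s}
    (hx : extNorm n s x ≤ r) : ‖g.1 x‖ ≤ holoSeminorm hs r g := by
  rw [← (hasSum_holoCoeff hs g x).tsum_eq]
  refine tsum_of_norm_bounded (summable_norm_holoCoeff hs g r.2).hasSum fun i => ?_
  rw [norm_mul]
  exact mul_le_mul_of_nonneg_left (norm_fundHolo_le i r.2 hx) (norm_nonneg _)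

/-- Each seminorm is small once `g` is small on the compact images of the tori of radius `2 r`.
Conversely `‖ξ‖ ‖η‖` is bounded on any compact set, so one seminorm controls the supremum there. -/
theorem withSeminorms_holoSeminorm (hs : 1 ≤ s) :
    WithSeminorms (holoSeminorm (n := n) hs) := by
  rw [SeminormFamily.withSeminorms_iff_nhds_eq_iInf]
  refine le_antisymm (le_iInf fun r => Filter.tendsto_iff_comap.1 ?_) ?_
  · have hr : (0 : ℝ) < r.1 := zero_lt_one.trans_le r.2
    set S := ∑' i : Idx n, (1 / 2 : ℝ) ^ (deg i.1 + deg i.2) with hS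
    have hsum := summable_geometric_idx n (t := 1 / 2) (by norm_num) (by norm_num)
    have hS0 : 0 ≤ S := tsum_nonneg fun i => by positivity
    rw [Metric.tendsto_nhds]
    intro ε hε
    have hδ : 0 < ε / (S + 1) := by positivity
    have hev : ∀ᶠ g : C(MredExt n s, ℂ) in nhds 0, Set.MapsTo g
        (paramL hs '' torusSet2 n (2 * r) ∪ paramR hs '' torusSet2 n (2 * r))
        (Metric.ball 0 (ε / (S + 1))) :=
      ContinuousMap.eventually_mapsTo (isCompact_param_torus hs _) Metric.isOpen_ball
        fun x _ => by simpa using hδ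
    have hev' : ∀ᶠ g : Holo n s in nhds 0, Set.MapsTo g.1
        (paramL hs '' torusSet2 n (2 * r) ∪ paramR hs '' torusSet2 n (2 * r))
        (Metric.ball 0 (ε / (S + 1))) :=
      (continuous_subtype_val.tendsto (0 : Holo n s)).eventually hev
    filter_upwards [hev'] with g hg
    -- `S` is the sum of the factors `(1 / 2)^(|P|+|Q|)`; dividing by `S + 1` makes the final
    -- inequality strict.
    have hle : holoSeminorm hs r g ≤ ε / (S + 1) * S := by
      rw [holoSeminorm_apply, hS, ← tsum_mul_left]
      exact (summable_norm_holoCoeff hs g r.2).tsum_le_tsum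
        (fun i => norm_holoCoeff_mul_pow_le hs hr (fun x hx => (mem_ball_zero_iff.1 (hg hx)).le) i)
        (hsum.mul_left _)
    rw [dist_zero_right, Real.norm_of_nonneg (apply_nonneg _ _)]
    refine hle.trans_lt ?_
    rw [div_mul_eq_mul_div, div_lt_iff₀ (by positivity)]
    nlinarith
  · rw [nhds_subtype_eq_comap, ← Filter.tendsto_iff_comap, ZeroMemClass.coe_zero,
      ContinuousMap.tendsto_iff_forall_isCompact_tendstoUniformlyOn]
    intro K hK
    obtain ⟨N, hN⟩ := (hK.exists_bound_of_continuousOn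
      (f := fun x => extNorm n s x) continuous_extNorm.continuousOn)
    have hr : 1 ≤ max 1 N := le_max_left _ _
    rw [Metric.tendstoUniformlyOn_iff]
    intro ε hε
    refine Filter.Eventually.filter_mono (iInf_le _ (⟨max 1 N, hr⟩ : {r : ℝ // 1 ≤ r})) ?_
    refine Filter.eventually_comap.2 ?_
    filter_upwards [gt_mem_nhds hε] with t ht g hg x hx
    rw [ContinuousMap.zero_apply, dist_zero_left]
    refine (norm_le_holoSeminorm hs ⟨max 1 N, hr⟩ g ?_).trans_lt (hg.trans_lt ht)
    exact (Real.le_norm_self _).trans ((hN x hx).trans (le_max_right _ _))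

/-- By biorthogonality the seminorm of a remainder is the tail of the convergent series defining the
seminorm of `g`. -/
theorem hasSum_smul_fundHolo (hs : 1 ≤ s) (g : Holo n s) :
    HasSum (fun i => holoCoeff hs i g • fundHolo n s i) g := by
  classical
  refine ((withSeminorms_holoSeminorm hs).tendsto_nhds _ _).2 fun r ε hε => ?_
  have ht := tendsto_tsum_compl_atTop_zero
    (fun i => ‖holoCoeff hs i g‖ * r.1 ^ (deg i.1 + deg i.2))
  filter_upwards [(tendsto_order.1 ht).2 ε hε] with S hS
  refine lt_of_eq_of_lt ?_ hS
  rw [holoSeminorm_apply]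
  refine Eq.trans ?_ (tsum_subtype {i | i ∉ S}
    (fun i => ‖holoCoeff hs i g‖ * r.1 ^ (deg i.1 + deg i.2))).symm
  refine tsum_congr fun i => ?_
  rw [map_sub, map_sum]
  simp only [map_smul, holoCoeff_fundHolo, smul_eq_mul, mul_ite, mul_one, mul_zero,
    Finset.sum_ite_eq']
  by_cases hi : i ∈ S <;> simp [hi]

theorem continuous_holoCoeff (hs : 1 ≤ s) (i : Idx n) : Continuous (holoCoeff (n := n) hs i) := by
  have := (withSeminorms_holoSeminorm (n := n) hs).topologicalAddGroup
  refine continuous_of_continuousAt_zero (holoCoeff hs i) ?_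
  rw [ContinuousAt, map_zero]
  refine squeeze_zero_norm (a := holoSeminorm hs ⟨1, le_rfl⟩) (fun g => ?_) ?_
  · refine le_trans (le_of_eq ?_) ((summable_norm_holoCoeff hs g le_rfl).le_tsum i
      fun j _ => by positivity)
    simp
  · simpa using (((withSeminorms_holoSeminorm (n := n) hs).continuous_seminorm
      ⟨1, le_rfl⟩).tendsto 0)

/-! ### Iterated torus integrals -/

/-- Links the probability measure on the torus to the angular parametrization in which
`torusIntegral` is defined. -/
theorem torus_eq_map (n : ℕ) (R : ℝ) :
    torus n R = ((ENNReal.ofReal (2 * Real.pi))⁻¹ ^ n •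
      (volume.restrict (Set.Icc (0 : Fin n → ℝ) fun _ => 2 * Real.pi))).map
        (torusMap 0 fun _ => R) := by
  have h1 : ∀ _ : Fin n, circ R = ((ENNReal.ofReal (2 * Real.pi))⁻¹ •
      volume.restrict (Set.Icc 0 (2 * Real.pi))).map (circleMap 0 R) := fun _ => by
    rw [circ, Measure.map_smul]
  have hfin : IsFiniteMeasure ((ENNReal.ofReal (2 * Real.pi))⁻¹ •
      volume.restrict (Set.Icc 0 (2 * Real.pi))) :=
    Measure.smul_finite _ (ENNReal.inv_ne_top.2 (by simp [Real.pi_pos]))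
  have h2 : Measure.pi (fun _ : Fin n => (ENNReal.ofReal (2 * Real.pi))⁻¹ •
      volume.restrict (Set.Icc 0 (2 * Real.pi))) = (ENNReal.ofReal (2 * Real.pi))⁻¹ ^ n •
      (volume.restrict (Set.Icc (0 : Fin n → ℝ) fun _ => 2 * Real.pi)) := by
    refine Measure.pi_eq fun t _ => ?_
    rw [← Set.pi_univ_Icc, volume_pi, Measure.restrict_pi_pi, Measure.smul_apply,
      Measure.pi_pi]
    simp [Finset.prod_mul_distrib]
  rw [← h2, torus, funext h1, ← Measure.pi_map_pi fun _ => (measurable_circleMap 0 R).aemeasurable]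
  congr 1

theorem measurable_torusMap (R : ℝ) : Measurable (torusMap (0 : Fin n → ℂ) fun _ => R) := by
  refine measurable_pi_lambda _ fun k => ?_
  unfold torusMap
  fun_prop

theorem torusMap_mem_torusSet {R : ℝ} (hR : 0 ≤ R) (θ : Fin n → ℝ) :
    torusMap 0 (fun _ => R) θ ∈ torusSet n R :=
  mem_torusSet.2 fun k => by simp [torusMap, Complex.norm_exp, abs_of_nonneg hR]

theorem torusIntegral_congr {R : ℝ} (hR : 0 ≤ R) {f g : (Fin n → ℂ) → ℂ}
    (h : ∀ z ∈ torusSet n R, f z = g z) :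
    torusIntegral f 0 (fun _ => R) = torusIntegral g 0 fun _ => R := by
  simp only [torusIntegral, h _ (torusMap_mem_torusSet hR _)]

theorem torusIntegral_eq_integral_torus {R : ℝ} {f : (Fin n → ℂ) → ℂ}
    (hf : AEStronglyMeasurable (fun z => (∏ k, z k) * f z) (torus n R)) :
    torusIntegral f 0 (fun _ => R)
      = (2 * Real.pi * Complex.I) ^ n * ∫ z, (∏ k, z k) * f z ∂torus n R := by
  rw [torus_eq_map] at hf ⊢
  rw [integral_map (measurable_torusMap R).aemeasurable hf, integral_smul_measure, torusIntegral,
    ENNReal.toReal_pow, ENNReal.toReal_inv, ENNReal.toReal_ofReal Real.two_pi_pos.le,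
    Complex.real_smul, ← mul_assoc, ← integral_const_mul]
  refine integral_congr_ae (Filter.Eventually.of_forall fun θ => ?_)
  have hpi : (Real.pi : ℂ) ≠ 0 := Complex.ofReal_ne_zero.2 Real.pi_ne_zero
  simp only [smul_eq_mul, torusMap, Pi.zero_apply, zero_add, Finset.prod_mul_distrib,
    Finset.prod_const, Finset.card_univ, Fintype.card_fin]
  push_cast
  have h : (2 * (Real.pi : ℂ) * Complex.I) ^ n * (2 * (Real.pi : ℂ))⁻¹ ^ n = Complex.I ^ n := by
    rw [← mul_pow]
    congr 1
    field_simp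
  rw [h]
  ring

/-- Each of the `2 n` differentials contributes `2πi` times its variable, and `(2πi)² = -4π²`. -/
theorem torusIntegral_torusIntegral {R : ℝ} (hR : 0 ≤ R) {H : (Fin n → ℂ) × (Fin n → ℂ) → ℂ}
    (hH : ContinuousOn H (torusSet2 n R)) :
    torusIntegral (fun u => torusIntegral (fun v => H (u, v)) 0 fun _ => R) 0 (fun _ => R)
      = (-4 * (Real.pi : ℂ) ^ 2) ^ n *
        ∫ p, (∏ k, p.1 k) * ((∏ k, p.2 k) * H p) ∂torus2 n R := by
  have hc : ContinuousOn (fun p : (Fin n → ℂ) × (Fin n → ℂ) =>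
      (∏ k, p.1 k) * ((∏ k, p.2 k) * H p)) (torusSet2 n R) :=
    ContinuousOn.mul (by fun_prop) (ContinuousOn.mul (by fun_prop) hH)
  have hint := integrable_torus2 hR hc
  have hinner : ∀ u ∈ torusSet n R, torusIntegral (fun v => H (u, v)) 0 (fun _ => R)
      = (2 * Real.pi * Complex.I) ^ n * ∫ v, (∏ k, v k) * H (u, v) ∂torus n R := fun u hu =>
    torusIntegral_eq_integral_torus (integrable_torus hR (ContinuousOn.mul (by fun_prop)
      (hH.comp (by fun_prop) fun v hv => ⟨hu, hv⟩))).aestronglyMeasurable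
  have hsplit : ∀ u : Fin n → ℂ, (∏ k, u k) *
      ((2 * Real.pi * Complex.I) ^ n * ∫ v, (∏ k, v k) * H (u, v) ∂torus n R)
      = (2 * Real.pi * Complex.I) ^ n *
        ∫ v, (∏ k, u k) * ((∏ k, v k) * H (u, v)) ∂torus n R := fun u => by
    rw [integral_const_mul]
    ring
  rw [torusIntegral_congr hR hinner, torusIntegral_eq_integral_torus]
  · simp only [hsplit]
    rw [integral_const_mul, ← mul_assoc, ← mul_pow, integral_prod _ hint]
    congr 2
    linear_combination (4 * (Real.pi : ℂ) ^ 2) * Complex.I_sq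
  · simp only [hsplit]
    exact (hint.aestronglyMeasurable.integral_prod_right').const_mul _

/-- The integral formula for the coefficients. -/
theorem holoCoeff_eq_torusIntegral (hs : 1 ≤ s) (g : Holo n s) {R : ℝ} (hR : 0 < R)
    (hR1 : R < 1 / Real.sqrt n) (P Q : Fin n → ℕ) :
    holoCoeff hs (P, Q) g = 1 / (-4 * (Real.pi : ℂ) ^ 2) ^ n *
      torusIntegral (fun u => torusIntegral (fun v => coordExpr n s 0 0 g.1 (u, v) *
        ((1 + ∑ k : Fin n, nu n s k.succ * u k * v k) ^ (((max (deg P) (deg Q) : ℕ) : ℤ) - 1) /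
          ((∏ k, u k ^ (P k + 1)) * ∏ k, v k ^ (Q k + 1)))) 0 fun _ => R) 0 fun _ => R := by
  -- For `n > 0` the bound `R < 1 / √n` is equivalent to `n R² < 1`, which excludes zeros of the
  -- quadric on the tori.
  have hR2 : (∑ k, ‖signs n s k‖) * R ^ 2 < 1 := by
    rw [sum_norm_signs]
    rcases Nat.eq_zero_or_pos n with rfl | hn
    · simp
    · have hn' : (0 : ℝ) < Real.sqrt n := Real.sqrt_pos.2 (Nat.cast_pos.2 hn)
      have h := (lt_div_iff₀ hn').1 hR1
      rw [← Real.sq_sqrt (Nat.cast_nonneg (α := ℝ) n), ← mul_pow, mul_comm]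
      exact pow_lt_one₀ (by positivity) h two_ne_zero
  have hm := momentMapExt_homog (n := n) hs
  have hF : ContinuousOn (coordExpr n s 0 0 g.1) (torusSet2 n R) :=
    (g.2 0 0).continuousOn.mono fun p hp => (hm p).trans_ne (quadric_ne_zero_of_mem hR2 hp)
  have hne : ∀ p ∈ torusSet2 n R, (∏ k, p.1 k ^ (P k + 1)) * ∏ k, p.2 k ^ (Q k + 1) ≠ 0 :=
    fun p hp => mul_ne_zero
      (Finset.prod_ne_zero_iff.2 fun k _ => pow_ne_zero _ (ne_zero_of_mem_torusSet hR hp.1 k))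
      (Finset.prod_ne_zero_iff.2 fun k _ => pow_ne_zero _ (ne_zero_of_mem_torusSet hR hp.2 k))
  have hpi : (-4 * (Real.pi : ℂ) ^ 2) ^ n ≠ 0 :=
    pow_ne_zero _ (mul_ne_zero (by norm_num) (pow_ne_zero _ (Complex.ofReal_ne_zero.2
      Real.pi_ne_zero)))
  have h := torusIntegral_torusIntegral hR.le (H := fun p => coordExpr n s 0 0 g.1 p *
      (quadric (signs n s) p ^ (((max (deg P) (deg Q) : ℕ) : ℤ) - 1) /
        ((∏ k, p.1 k ^ (P k + 1)) * ∏ k, p.2 k ^ (Q k + 1))))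
      (hF.mul ((continuousOn_quadric_zpow hR2 _).div (by fun_prop) hne))
  refine Eq.trans ?_ (congrArg (1 / (-4 * (Real.pi : ℂ) ^ 2) ^ n * ·) h).symm
  rw [one_div, inv_mul_cancel_left₀ hpi, ← laurentCoeff_coordExpr hs g hR hR2, laurentCoeff]
  refine integral_congr_ae ((ae_torus2 hR.le).mono fun p hp => ?_)
  have hz : ∀ (P : Fin n → ℕ) (z : Fin n → ℂ), zmon (-intIdx P) z = (∏ k, z k ^ P k)⁻¹ :=
    fun P z => by simp [zmon, intIdx]
  have hu := hne p hp
  simp only [hz, pow_succ, Finset.prod_mul_distrib] at hu ⊢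
  have h1 := mul_ne_zero_iff.1 (mul_ne_zero_iff.1 hu).1
  have h2 := mul_ne_zero_iff.1 (mul_ne_zero_iff.1 hu).2
  obtain ⟨h11, h12⟩ := h1
  obtain ⟨h21, h22⟩ := h2
  field_simp

/-! ### Transport to the analytic functions -/

/-- The restriction as a linear equivalence. -/
def restrictEquiv (hs : 1 ≤ s) : Holo n s ≃ₗ[ℂ] Analytic n s :=
  LinearEquiv.ofBijective (restrict n s)
    ⟨restrict_injective hs, LinearMap.surjective_rangeRestrict _⟩

theorem restrictEquiv_symm_restrict (hs : 1 ≤ s) (g : Holo n s) :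
    (restrictEquiv hs).symm (restrict n s g) = g :=
  (restrictEquiv hs).symm_apply_apply g

theorem restrict_restrictEquiv_symm (hs : 1 ≤ s) (f : Analytic n s) :
    restrict n s ((restrictEquiv hs).symm f) = f :=
  (restrictEquiv hs).apply_symm_apply f

theorem continuous_restrict : Continuous (restrict n s) := continuous_coinduced_rng

theorem coinduced_eq_induced_of_inverse {X Y : Type*} [t : TopologicalSpace X] {f : X → Y}
    {g : Y → X} (hgf : Function.LeftInverse g f) (hfg : Function.RightInverse g f) :
    TopologicalSpace.coinduced f t = TopologicalSpace.induced g t :=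
  congrFun (Equiv.coinduced_symm (⟨g, f, hfg, hgf⟩ : Y ≃ X)) t

/-- For a bijection the coinduced topology is the one induced by the inverse, the form in which
seminorms pull back. -/
theorem topology_analytic (hs : 1 ≤ s) :
    instTopologicalSpaceAnalytic n s
      = TopologicalSpace.induced (restrictEquiv hs).symm instTopologicalSpaceSubtype := by
  exact coinduced_eq_induced_of_inverse (restrictEquiv_symm_restrict hs)
    (restrict_restrictEquiv_symm hs)

theorem continuous_restrictEquiv_symm (hs : 1 ≤ s) : Continuous (restrictEquiv (n := n) hs).symm :=
  continuous_iff_le_induced.2 (topology_analytic hs).le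

/-- The coefficient functionals on the analytic functions. -/
def coeffCLM (hs : 1 ≤ s) (i : Idx n) : Analytic n s →L[ℂ] ℂ where
  toLinearMap := (holoCoeff hs i).comp (restrictEquiv hs).symm.toLinearMap
  cont := (continuous_holoCoeff hs i).comp (continuous_restrictEquiv_symm hs)

theorem coeffCLM_apply (hs : 1 ≤ s) (i : Idx n) (f : Analytic n s) :
    coeffCLM hs i f = holoCoeff hs i ((restrictEquiv hs).symm f) := rfl

theorem coeffCLM_restrict (hs : 1 ≤ s) (i : Idx n) (g : Holo n s) :
    coeffCLM hs i (restrict n s g) = holoCoeff hs i g := by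
  rw [coeffCLM_apply, restrictEquiv_symm_restrict]

theorem coeffCLM_fundMonom (hs : 1 ≤ s) (i j : Idx n) :
    coeffCLM hs j (fundMonom n s i) = if i = j then 1 else 0 := by
  rw [← restrict_fundHolo, coeffCLM_restrict, holoCoeff_fundHolo]

/-- The seminorms `‖ ‖_{red, r}`. -/
def redSeminorm (hs : 1 ≤ s) : SeminormFamily ℂ (Analytic n s) {r : ℝ // 1 ≤ r} :=
  fun r => (holoSeminorm (n := n) hs r).comp (restrictEquiv (n := n) hs).symm.toLinearMap

theorem redSeminorm_apply (hs : 1 ≤ s) (r : {r : ℝ // 1 ≤ r}) (f : Analytic n s) :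
    redSeminorm hs r f = ∑' i, ‖coeffCLM hs i f‖ * (r : ℝ) ^ (deg i.1 + deg i.2) := rfl

theorem withSeminorms_redSeminorm (hs : 1 ≤ s) : WithSeminorms (redSeminorm (n := n) hs) := by
  have h := LinearMap.withSeminorms_induced (withSeminorms_holoSeminorm (n := n) hs)
    (restrictEquiv hs).symm.toLinearMap
  have e := topology_analytic (n := n) hs
  rw [e]
  exact h

theorem summable_norm_coeffCLM (hs : 1 ≤ s) (f : Analytic n s) {r : ℝ} (hr : 1 ≤ r) :
    Summable fun i => ‖coeffCLM hs i f‖ * r ^ (deg i.1 + deg i.2) :=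
  summable_norm_holoCoeff hs _ hr

theorem redSeminorm_fundMonom (hs : 1 ≤ s) (r : {r : ℝ // 1 ≤ r}) (i : Idx n) :
    redSeminorm hs r (fundMonom n s i) = (r : ℝ) ^ (deg i.1 + deg i.2) := by
  classical
  rw [redSeminorm_apply, tsum_eq_single i fun j hj => by
    rw [coeffCLM_fundMonom, if_neg hj.symm, norm_zero, zero_mul]]
  rw [coeffCLM_fundMonom, if_pos rfl, norm_one, one_mul]

theorem hasSum_coeffCLM (hs : 1 ≤ s) (f : Analytic n s) :
    HasSum (fun i => coeffCLM hs i f • fundMonom n s i) f := by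
  have h := (hasSum_smul_fundHolo hs ((restrictEquiv hs).symm f)).map (restrict n s)
    continuous_restrict
  rw [restrict_restrictEquiv_symm] at h
  convert! h using 2 with i
  rw [Function.comp_apply, map_smul, restrict_fundHolo, coeffCLM_apply]

/-- Uniqueness follows by applying the continuous coefficient functionals, which are biorthogonal to
the monomials, to any convergent expansion. -/
theorem isAbsoluteSchauderBasis_fundMonom (hs : 1 ≤ s) :
    IsAbsoluteSchauderBasis (fundMonom n s) (coeffCLM hs) where
  hasSum := hasSum_coeffCLM hs
  unique f a h := by
    classical
    funext j
    refine HasSum.unique ?_ ((coeffCLM hs j).hasSum h)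
    convert! hasSum_single (f := fun i => coeffCLM hs j (a i • fundMonom n s i)) j
      fun i hi => ?_ using 1
    · simp [coeffCLM_fundMonom]
    · simp [coeffCLM_fundMonom, hi]
  unique_enum σ f a h := by
    classical
    funext j
    refine tendsto_nhds_unique ?_ (((coeffCLM hs j).continuous.tendsto f).comp h)
    refine tendsto_const_nhds.congr' ?_
    filter_upwards [Filter.eventually_gt_atTop (σ.symm j)] with N hN
    simp only [Function.comp_apply, map_sum, map_smul, coeffCLM_fundMonom, smul_eq_mul, mul_ite,
      mul_one, mul_zero]
    rw [Finset.sum_eq_single (σ.symm j) (fun m _ hm => if_neg fun h => hm (by simp [← h]))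
      fun h => absurd (Finset.mem_range.2 hN) h]
    simp
  absolute p hp := by
    obtain ⟨S, C, -, hC⟩ := Seminorm.bound_of_continuous (withSeminorms_redSeminorm hs) p hp
    have : Nonempty {r : ℝ // 1 ≤ r} := ⟨⟨1, le_rfl⟩⟩
    -- Only the values on the basis matter, where the seminorm of index `r` equals `r^(|P|+|Q|)`.
    -- This increases with `r`, so a single `r` dominates the finitely many seminorms bounding `p`.
    obtain ⟨r, hr⟩ := S.exists_le
    have hr0 : (0 : ℝ) ≤ r := zero_le_one.trans r.2
    have hp : ∀ i, p (fundMonom n s i) ≤ C * (r : ℝ) ^ (deg i.1 + deg i.2) := fun i => by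
      refine (hC _).trans ?_
      rw [smul_apply, NNReal.smul_def, smul_eq_mul]
      refine mul_le_mul_of_nonneg_left (Seminorm.finset_sup_apply_le (by positivity)
        fun t ht => ?_) C.2
      rw [redSeminorm_fundMonom]
      exact pow_le_pow_left₀ (zero_le_one.trans t.2) (hr t ht) _
    have hle : ∀ f i, ‖coeffCLM hs i f‖ * p (fundMonom n s i)
        ≤ C * (‖coeffCLM hs i f‖ * (r : ℝ) ^ (deg i.1 + deg i.2)) := fun f i => by
      rw [mul_left_comm]
      exact mul_le_mul_of_nonneg_left (hp i) (norm_nonneg _)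
    have hsum := fun f : Analytic n s => (summable_norm_coeffCLM hs f r.2).mul_left (C : ℝ)
    have hsum' : ∀ f : Analytic n s, Summable fun i => ‖coeffCLM hs i f‖ * p (fundMonom n s i) := fun f =>
      Summable.of_nonneg_of_le (fun i => mul_nonneg (norm_nonneg _) (apply_nonneg p _)) (hle f) (hsum f)
    refine ⟨C • redSeminorm hs r, ?_, fun f => ⟨hsum' f, ?_⟩⟩
    · exact ((withSeminorms_redSeminorm hs).continuous_seminorm r).const_smul C
    · rw [smul_apply, redSeminorm_apply, NNReal.smul_def, smul_eq_mul, ← tsum_mul_left]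
      exact (hsum' f).tsum_le_tsum (hle f) (hsum f)

end

end WickRed

theorem mainTheorem8 (n s : ℕ) (hn : 1 ≤ n) (hs : 1 ≤ s) (hsn : s ≤ n + 1) :
    ∃ c : (Fin n → ℕ) × (Fin n → ℕ) → (WickRed.Analytic n s →L[ℂ] ℂ),
      -- absolute Schauder basis, with unique coefficients `c (P, Q) f`
      WickRed.IsAbsoluteSchauderBasis (WickRed.fundMonom n s) c ∧
      -- the estimate on the coefficients
      (∀ (f : WickRed.Analytic n s) (r : ℝ), 1 ≤ r →
        Summable fun i : (Fin n → ℕ) × (Fin n → ℕ) =>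
          ‖c i f‖ * r ^ (WickRed.deg i.1 + WickRed.deg i.2)) ∧
      -- the resulting seminorms describe the topology
      (∃ p : {r : ℝ // 1 ≤ r} → Seminorm ℂ (WickRed.Analytic n s),
        (∀ r f, p r f = ∑' i : (Fin n → ℕ) × (Fin n → ℕ),
          ‖c i f‖ * (r : ℝ) ^ (WickRed.deg i.1 + WickRed.deg i.2)) ∧
        WithSeminorms p) ∧
      -- the integral formula
      (∀ (f : WickRed.Analytic n s) (g : WickRed.Holo n s), WickRed.restrict n s g = f →
        ∀ R : ℝ, 0 < R → R < 1 / Real.sqrt n → ∀ P Q : Fin n → ℕ,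
          c (P, Q) f = 1 / (-4 * (Real.pi : ℂ) ^ 2) ^ n *
            ∯ u in T(0, fun _ : Fin n => R), ∯ v in T(0, fun _ : Fin n => R),
              WickRed.coordExpr n s 0 0 (g : C(WickRed.MredExt n s, ℂ)) (u, v) *
                ((1 + ∑ k : Fin n, WickRed.nu n s k.succ * u k * v k) ^
                    (((max (WickRed.deg P) (WickRed.deg Q) : ℕ) : ℤ) - 1) /
                  ((∏ k, u k ^ (P k + 1)) * ∏ k, v k ^ (Q k + 1)))) := by
  refine ⟨WickRed.coeffCLM hs, WickRed.isAbsoluteSchauderBasis_fundMonom hs,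
    fun f r hr => WickRed.summable_norm_coeffCLM hs f hr,
    ⟨WickRed.redSeminorm hs, fun r f => WickRed.redSeminorm_apply hs r f,
      WickRed.withSeminorms_redSeminorm hs⟩, ?_⟩
  rintro f g rfl R hR hR1 P Q
  rw [WickRed.coeffCLM_restrict]
  exact WickRed.holoCoeff_eq_torusIntegral hs g hR hR1 P Q

end
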